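/- Let $d\ge 3$ and let $\mathbb T^d=(\mathbb R/2\pi\mathbb Z)^d\equiv[-\pi,\pi)^d$ carry the normalized Haar measure $\eta$. Let $\varepsilon:\mathbb T^d\to\mathbb R$ be an even Morse function of class $C^3$ with a unique minimum, at $0$, and let $\hat v:\mathbb Z^d\to(-\infty,0]$ be even with $\sum_x|\hat v(x)|<\infty$. For $k\in\mathbb T^d$ put $$\mathcal E_k(p)=\varepsilon\left(\tfrac k2+p\right)+\varepsilon\left(\tfrac k2-p\right),\qquad \mathcal E_{\min}(k)=\min_{p\in\mathbb T^d}\mathcal E_k(p),\qquad \hat{\mathcal E}_k(x)=\int_{\mathbb T^d}e^{-i(p,x)}\mathcal E_k(p)\,\eta(dp),$$ where $k/2$ is formed from the representative of $k$ in $[-\pi,\pi)^d$. Let $\mathbb G\subset\mathbb T^d$ be the largest open set such that for each $k\in\mathbb G$ the function $\mathcal E_k$ is a Morse function whose minimum is attained at $p=0$. On the Hilbert space $\ell^{2,e}(\mathbb Z^d)$ of even square-summable functions let, for $\mu>0$, $$(\widehat H_\mu(k)\hat f)(x)=\sum_{s\in\mathbb Z^d}\hat{\mathcal E}_k(x-s)\hat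 f(s)+\mu\,\hat v(x)\hat f(x),$$ and, for $k\in\mathbb G$, let $\mathbb B_\mu(k,\mathcal E_{\min}(k))$ be the generalized Birman--Schwinger operator, that is, the operator on $\ell^{2,e}(\mathbb Z^d)$ with the kernel $$\mu\,|\hat v(x)|^{1/2}\left(\int_{\mathbb T^d}\frac{e^{i(q,x-y)}}{\mathcal E_k(q)-\mathcal E_{\min}(k)}\,\eta(dq)\right)|\hat v(y)|^{1/2},\qquad x,y\in\mathbb Z^d.$$ Let $\mu_0>0$ and $k_0\in\mathbb G$ be such that $\mathcal E_{\min}(k_0)$ is a regular point of the essential spectrum of $\widehat H_{\mu_0}(k_0)$, i.e. $1$ is not an eigenvalue of $\mathbb B_{\mu_0}(k_0,\mathcal E_{\min}(k_0))$. Then there exist open neighbourhoods $U(\mu_0)\subset(0,\infty)$ of $\mu_0$ and $G(k_0)\subset\mathbb G$ of $k_0$ such that the number of eigenvalues of $\widehat H_\mu(k)$ below $\mathcal E_{\min}(k)$, counted with multiplicity, is finite and is the same for all $\mu\in U(\mu_0)$ and $k\in G(k_0)$. -/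

import Mathlib

open MeasureTheory

noncomputable section

namespace LatticePair

/-- The lattice `ℤᵈ`. -/
abbrev Lattice (d : ℕ) : Type := Fin d → ℤ

/-- The torus `𝕋ᵈ`, the dual group of `ℤᵈ`. It is Mathlib's `(ℝ/ℤ)ᵈ`, i.e. momenta are measured in
units of `2π`: the point with real coordinates `t` is the momentum `p = 2πt`, and the character
`UnitAddTorus.mFourier x` is `p ↦ exp (i (p, x))`. -/
abbrev Torus (d : ℕ) : Type := UnitAddTorus (Fin d)

/-- The normalized Haar measure `η` on the torus. -/
def haar (d : ℕ) : Measure (Torus d) := Measure.pi fun _ => AddCircle.haarAddCircle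

/-- The quotient map `ℝᵈ → 𝕋ᵈ`. -/
def toTorus {d : ℕ} (t : Fin d → ℝ) : Torus d := fun i => (t i : UnitAddCircle)

/-- `k / 2`, where `k` is identified with its representative in `[-1/2, 1/2)ᵈ`
(this is `[-π, π)ᵈ` for momenta in the usual units). -/
def half {d : ℕ} (k : Torus d) : Torus d :=
  toTorus fun i => (AddCircle.equivIco (1 : ℝ) (-(1 / 2)) (k i) : ℝ) / 2

/-! ### Dispersion relations -/

/-- A `C²` function on the torus is a Morse function if at each of its critical points its Hessian
is a nondegenerate bilinear form. Derivatives are those of the periodic lift to `ℝᵈ`. -/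
def IsMorse {d : ℕ} (f : Torus d → ℝ) : Prop :=
  ContDiff ℝ 2 (f ∘ toTorus) ∧
    ∀ t : Fin d → ℝ, fderiv ℝ (f ∘ toTorus) t = 0 →
      ∀ u : Fin d → ℝ, (∀ w : Fin d → ℝ, fderiv ℝ (fderiv ℝ (f ∘ toTorus)) t u w = 0) → u = 0

/-- The hypothesis on the one-particle dispersion relation `ε`: an even Morse function of class
`C³` with a unique minimum, at `0`. -/
structure IsDispersion {d : ℕ} (ε : C(Torus d, ℝ)) : Prop where
  contDiff : ContDiff ℝ 3 (ε ∘ toTorus)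
  even : ∀ p, ε (-p) = ε p
  morse : IsMorse ε
  unique_min : ∀ p, p ≠ 0 → ε 0 < ε p

/-- The hypothesis on the pair interaction `v`: a non-positive absolutely summable function on the
lattice, even because the particles are identical. -/
structure PairPotential (d : ℕ) where
  toFun : Lattice d → ℝ
  nonpos : ∀ x, toFun x ≤ 0
  summable : Summable toFun
  even : ∀ x, toFun (-x) = toFun x

/-- The pair dispersion relation `ℰ_k(p) = ε(k/2 + p) + ε(k/2 - p)`. -/
def pairDispersion {d : ℕ} (ε : C(Torus d, ℝ)) (k : Torus d) : C(Torus d, ℝ) where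
  toFun p := ε (half k + p) + ε (half k - p)

/-- The threshold `ℰ_min(k)`, the minimum of `ℰ_k` over the torus. -/
def threshold {d : ℕ} (ε : C(Torus d, ℝ)) (k : Torus d) : ℝ := ⨅ q, pairDispersion ε k q

/-- The region `𝔾`: the largest open set of quasi-momenta `k` for which `ℰ_k` is a Morse function
whose minimum is attained at `0`. -/
def region {d : ℕ} (ε : C(Torus d, ℝ)) : Set (Torus d) :=
  interior {k | IsMorse (pairDispersion ε k) ∧ ∀ q, pairDispersion ε k 0 ≤ pairDispersion ε k q}

/-! ### Operators on even square-summable functions -/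

/-- The Hilbert space `ℓ²(ℤᵈ)`. -/
abbrev L2 (d : ℕ) : Type := lp (fun _ : Lattice d => ℂ) 2

/-- The Hilbert space `ℓ^{2,e}(ℤᵈ)` of even square-summable functions. -/
def evenL2 (d : ℕ) : Submodule ℂ (L2 d) where
  carrier := {f | ∀ x, f (-x) = f x}
  add_mem' := by
    intro f g hf hg x
    simp only [lp.coeFn_add, Pi.add_apply]
    rw [hf x, hg x]
  zero_mem' := by
    intro x
    simp
  smul_mem' := by
    intro c f hf x
    simp only [lp.coeFn_smul, Pi.smul_apply]
    rw [hf x]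

/-- The operator `f ↦ (x ↦ ∑ y, K x y * f y)` on even functions with an admissible kernel `K`. -/
def kernelOperator {d : ℕ} (K : Lattice d → Lattice d → ℂ)
    (hs : ∀ (f : L2 d) (x : Lattice d), Summable fun y => K x y * f y)
    (hm : ∀ f : L2 d, Memℓp (fun x => ∑' y, K x y * f y) 2)
    (he : ∀ x y, K (-x) (-y) = K x y) : Module.End ℂ (evenL2 d) where
  toFun f := ⟨⟨fun x => ∑' y, K x y * (f : L2 d) y, hm f⟩, by
    intro x
    change ∑' y, K (-x) y * (f : L2 d) y = ∑' y, K x y * (f : L2 d) y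
    rw [← (Equiv.neg (Lattice d)).tsum_eq]
    refine tsum_congr fun y => ?_
    have h := f.2 y
    change K (-x) (-y) * (f : L2 d) (-y) = _
    rw [he, h]⟩
  map_add' f g := by
    apply Subtype.ext
    apply lp.ext
    funext x
    change ∑' y, K x y * (((f + g : evenL2 d) : L2 d) y)
      = ∑' y, K x y * (f : L2 d) y + ∑' y, K x y * (g : L2 d) y
    rw [← (hs f x).tsum_add (hs g x)]
    refine tsum_congr fun y => ?_
    simp [mul_add]
  map_smul' c f := by
    apply Subtype.ext
    apply lp.ext
    funext x
    change ∑' y, K x y * (((c • f : evenL2 d) : L2 d) y) = c * ∑' y, K x y * (f : L2 d) y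
    rw [← tsum_mul_left]
    refine tsum_congr fun y => ?_
    simp only [Submodule.coe_smul, lp.coeFn_smul, Pi.smul_apply, smul_eq_mul]
    ring

/-- The Fourier coefficient `∫ exp (-i (p, x)) ℰ_k(p) η(dp)`. -/
def pairHopping {d : ℕ} (ε : C(Torus d, ℝ)) (k : Torus d) (x : Lattice d) : ℂ :=
  ∫ p, UnitAddTorus.mFourier (-x) p * (pairDispersion ε k p : ℂ) ∂haar d

instance haar_isProbability (d : ℕ) : IsProbabilityMeasure (haar d) := by
  unfold haar; infer_instance

instance haar_isNegInvariant (d : ℕ) : (haar d).IsNegInvariant := by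
  have h : (AddCircle.haarAddCircle : Measure UnitAddCircle).IsNegInvariant :=
    Measure.IsAddHaarMeasure.isNegInvariant_of_regular _
  exact Measure.pi.isNegInvariant _

theorem pairDispersion_neg {d : ℕ} (ε : C(Torus d, ℝ)) (k p : Torus d) :
    pairDispersion ε k (-p) = pairDispersion ε k p := by
  simp only [pairDispersion, ContinuousMap.coe_mk, sub_neg_eq_add, ← sub_eq_add_neg]
  exact add_comm _ _

theorem mFourier_neg_neg {d : ℕ} (x : Lattice d) (p : Torus d) :
    UnitAddTorus.mFourier (-x) (-p) = UnitAddTorus.mFourier x p := by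
  simp [UnitAddTorus.mFourier]

theorem pairHopping_neg {d : ℕ} (ε : C(Torus d, ℝ)) (k : Torus d) (x : Lattice d) :
    pairHopping ε k (-x) = pairHopping ε k x := by
  unfold pairHopping
  rw [← integral_neg_eq_self]
  refine integral_congr_ae (Filter.Eventually.of_forall fun p => ?_)
  simp only [pairDispersion_neg, mFourier_neg_neg]

/-- Convolution with the Fourier coefficients of `ℰ_k` is multiplication by `ℰ_k` in momentum
space, hence acts in `ℓ²`. -/
theorem exists_hasSum_pairHopping {d : ℕ} (ε : C(Torus d, ℝ)) (k : Torus d) (f : L2 d) :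
    ∃ g : L2 d, ∀ x, HasSum (fun s => pairHopping ε k (x - s) * f s) (g x) := by
  let b : HilbertBasis (Lattice d) ℂ (Lp ℂ 2 (haar d)) := UnitAddTorus.mFourierBasis
  have hb : ∀ x, b x = ContinuousMap.toLp (E := ℂ) 2 (haar d) ℂ (UnitAddTorus.mFourier x) :=
    fun x => congrFun UnitAddTorus.coe_mFourierBasis x
  let e : C(Torus d, ℂ) := ⟨fun p => (pairDispersion ε k p : ℂ), by fun_prop⟩
  have he : ∀ p, (starRingEnd ℂ) (e p) = e p := fun p => Complex.conj_ofReal _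
  let F : Lp ℂ 2 (haar d) := b.repr.symm f
  have hG : MemLp (fun p => e p * F p) 2 (haar d) := by
    refine MemLp.of_le_mul (c := ‖e‖) (Lp.memLp F)
      (e.continuous.aestronglyMeasurable.mul (Lp.aestronglyMeasurable F))
      (Filter.Eventually.of_forall fun p => ?_)
    rw [norm_mul]
    exact mul_le_mul_of_nonneg_right (e.norm_coe_le_norm p) (norm_nonneg _)
  refine ⟨b.repr (hG.toLp _), fun x => ?_⟩
  let A : C(Torus d, ℂ) := e * UnitAddTorus.mFourier x
  have key := b.hasSum_inner_mul_inner (ContinuousMap.toLp (E := ℂ) 2 (haar d) ℂ A) F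
  have h1 : b.repr (hG.toLp _) x = inner ℂ (ContinuousMap.toLp (E := ℂ) 2 (haar d) ℂ A) F := by
    rw [b.repr_apply_apply, hb, L2.inner_def, L2.inner_def]
    refine integral_congr_ae ?_
    filter_upwards [ContinuousMap.coeFn_toLp (𝕜 := ℂ) (p := 2) (haar d) A, hG.coeFn_toLp,
      ContinuousMap.coeFn_toLp (𝕜 := ℂ) (p := 2) (haar d) (UnitAddTorus.mFourier x)]
      with p hp1 hp2 hp3
    rw [hp1, hp2, hp3]
    simp only [RCLike.inner_apply, A, ContinuousMap.mul_apply, map_mul, he]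
    ring
  rw [h1]
  refine key.congr_fun fun s => ?_
  have h2 : inner ℂ (b s) F = f s := by
    rw [← b.repr_apply_apply]
    simp [F]
  rw [h2, hb, ContinuousMap.inner_toLp]
  congr 1
  unfold pairHopping
  refine integral_congr_ae (Filter.Eventually.of_forall fun p => ?_)
  simp only [A, ContinuousMap.mul_apply, map_mul, he]
  rw [neg_sub, sub_eq_add_neg, UnitAddTorus.mFourier_add, UnitAddTorus.mFourier_neg]
  simp only [e, ContinuousMap.coe_mk]
  ring

/-- The free operator `Ĥ₀(k)`, with kernel `(x, s) ↦ ℰ̂_k(x - s)`. -/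
def freeOperator {d : ℕ} (ε : C(Torus d, ℝ)) (k : Torus d) : Module.End ℂ (evenL2 d) :=
  kernelOperator (fun x s => pairHopping ε k (x - s))
    (fun f x => by
      obtain ⟨g, hg⟩ := exists_hasSum_pairHopping ε k f
      exact (hg x).summable)
    (fun f => by
      obtain ⟨g, hg⟩ := exists_hasSum_pairHopping ε k f
      have h : (fun x => ∑' s, pairHopping ε k (x - s) * f s) = g :=
        funext fun x => (hg x).tsum_eq
      rw [h]
      exact lp.memℓp g)
    (fun x s => by
      rw [← pairHopping_neg]
      congr 1
      abel)

theorem PairPotential.abs_le {d : ℕ} (v : PairPotential d) (x : Lattice d) :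
    |v.toFun x| ≤ ∑' y, |v.toFun y| :=
  v.summable.abs.le_tsum x fun _ _ => abs_nonneg _

theorem memℓp_potential_mul {d : ℕ} (v : PairPotential d) (f : L2 d) :
    Memℓp (fun x => (v.toFun x : ℂ) * f x) 2 := by
  have h := ((lp.memℓp f).norm).const_smul (∑' y, |v.toFun y|)
  refine h.mono fun x => ?_
  rw [Pi.smul_apply, smul_eq_mul, norm_mul, Complex.norm_real, Real.norm_eq_abs]
  exact mul_le_mul_of_nonneg_right (v.abs_le x) (norm_nonneg _)

/-- The interaction operator `V̂`, multiplication by `v`. -/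
def interaction {d : ℕ} (v : PairPotential d) : Module.End ℂ (evenL2 d) where
  toFun f := ⟨⟨fun x => (v.toFun x : ℂ) * (f : L2 d) x, memℓp_potential_mul v f⟩, by
    intro x
    have h := f.2 x
    change (v.toFun (-x) : ℂ) * (f : L2 d) (-x) = (v.toFun x : ℂ) * (f : L2 d) x
    rw [v.even, h]⟩
  map_add' f g := by
    apply Subtype.ext
    apply lp.ext
    funext x
    exact mul_add _ _ _
  map_smul' c f := by
    apply Subtype.ext
    apply lp.ext
    funext x
    exact mul_left_comm _ _ _

/-- The Schrödinger operator `Ĥ_μ(k) = Ĥ₀(k) + μ V̂` on `ℓ^{2,e}(ℤᵈ)`. -/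
def schrodinger {d : ℕ} (ε : C(Torus d, ℝ)) (v : PairPotential d) (μ : ℝ) (k : Torus d) :
    Module.End ℂ (evenL2 d) :=
  freeOperator ε k + (μ : ℂ) • interaction v

/-- `∫ exp (i (q, x)) / (ℰ_k(q) - ℰ_min(k)) η(dq)`, the resolvent kernel at the threshold. -/
def thresholdResolvent {d : ℕ} (ε : C(Torus d, ℝ)) (k : Torus d) (x : Lattice d) : ℂ :=
  ∫ q, UnitAddTorus.mFourier x q / ((pairDispersion ε k q - threshold ε k : ℝ) : ℂ) ∂haar d

/-- The kernel `μ |v(x)|^{1/2} R̂₀(k, ℰ_min(k); x - y) |v(y)|^{1/2}`. -/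
def birmanSchwingerKernel {d : ℕ} (ε : C(Torus d, ℝ)) (v : PairPotential d) (μ : ℝ)
    (k : Torus d) (x y : Lattice d) : ℂ :=
  (μ : ℂ) * (√|v.toFun x| : ℝ) * thresholdResolvent ε k (x - y) * (√|v.toFun y| : ℝ)

theorem thresholdResolvent_neg {d : ℕ} (ε : C(Torus d, ℝ)) (k : Torus d) (x : Lattice d) :
    thresholdResolvent ε k (-x) = thresholdResolvent ε k x := by
  unfold thresholdResolvent
  rw [← integral_neg_eq_self]
  refine integral_congr_ae (Filter.Eventually.of_forall fun p => ?_)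
  simp only [pairDispersion_neg, mFourier_neg_neg]

theorem exists_norm_thresholdResolvent_le {d : ℕ} (ε : C(Torus d, ℝ)) (k : Torus d) :
    ∃ C : ℝ, ∀ x, ‖thresholdResolvent ε k x‖ ≤ C := by
  refine ⟨∫ q, ‖((pairDispersion ε k q - threshold ε k : ℝ) : ℂ)‖⁻¹ ∂haar d, fun x => ?_⟩
  refine (norm_integral_le_integral_norm _).trans (le_of_eq ?_)
  refine integral_congr_ae (Filter.Eventually.of_forall fun q => ?_)
  simp only [norm_div, UnitAddTorus.mFourier, ContinuousMap.coe_mk, norm_prod, fourier_apply, Circle.norm_coe,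
    Finset.prod_const_one, one_div]

theorem birmanSchwingerKernel_bound {d : ℕ} (ε : C(Torus d, ℝ)) (v : PairPotential d) (μ : ℝ)
    (k : Torus d) : ∃ C : ℝ, ∀ x y,
      ‖birmanSchwingerKernel ε v μ k x y‖ ≤ C * √|v.toFun x| * √|v.toFun y| := by
  obtain ⟨C, hC⟩ := exists_norm_thresholdResolvent_le ε k
  refine ⟨|μ| * C, fun x y => ?_⟩
  unfold birmanSchwingerKernel
  simp only [norm_mul, Complex.norm_real, Real.norm_eq_abs, abs_of_nonneg (Real.sqrt_nonneg _)]
  have h := mul_le_mul_of_nonneg_left (hC (x - y))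
    (by positivity : 0 ≤ |μ| * √|v.toFun x| * √|v.toFun y|)
  linarith

theorem summable_sqrt_mul {d : ℕ} (v : PairPotential d) (f : L2 d) :
    Summable fun y => √|v.toFun y| * ‖f y‖ := by
  have hf : Summable fun y => ‖f y‖ ^ 2 := by
    simpa using (memℓp_gen_iff (p := 2) (by norm_num)).1 (lp.memℓp f)
  refine Summable.of_nonneg_of_le (fun y => by positivity) (fun y => ?_) (v.summable.abs.add hf)
  have h := Real.sq_sqrt (abs_nonneg (v.toFun y))
  nlinarith [sq_nonneg (√|v.toFun y| - ‖f y‖), sq_nonneg (‖f y‖), abs_nonneg (v.toFun y)]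

theorem birmanSchwingerKernel_term_le {d : ℕ} (ε : C(Torus d, ℝ)) (v : PairPotential d) (μ : ℝ)
    (k : Torus d) : ∃ C : ℝ, ∀ (f : L2 d) (x y : Lattice d),
      ‖birmanSchwingerKernel ε v μ k x y * f y‖
        ≤ C * √|v.toFun x| * (√|v.toFun y| * ‖f y‖) := by
  obtain ⟨C, hC⟩ := birmanSchwingerKernel_bound ε v μ k
  refine ⟨C, fun f x y => ?_⟩
  rw [norm_mul, ← mul_assoc]
  exact mul_le_mul_of_nonneg_right (hC x y) (norm_nonneg _)

/-- The generalized Birman-Schwinger operator `𝔹_μ(k, ℰ_min(k))` on `ℓ^{2,e}(ℤᵈ)`. -/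
def birmanSchwinger {d : ℕ} (ε : C(Torus d, ℝ)) (v : PairPotential d) (μ : ℝ) (k : Torus d) :
    Module.End ℂ (evenL2 d) :=
  kernelOperator (birmanSchwingerKernel ε v μ k)
    (fun f x => by
      obtain ⟨C, hC⟩ := birmanSchwingerKernel_term_le ε v μ k
      exact Summable.of_norm_bounded ((summable_sqrt_mul v f).mul_left _) (hC f x))
    (fun f => by
      obtain ⟨C, hC⟩ := birmanSchwingerKernel_term_le ε v μ k
      have hs := summable_sqrt_mul v f
      have hb : ∀ x, ‖∑' y, birmanSchwingerKernel ε v μ k x y * f y‖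
          ≤ C * √|v.toFun x| * ∑' y, √|v.toFun y| * ‖f y‖ := fun x =>
        tsum_of_norm_bounded (hs.hasSum.mul_left _) (hC f x)
      refine memℓp_gen ?_
      simp only [ENNReal.toReal_ofNat, Real.rpow_ofNat]
      refine Summable.of_nonneg_of_le (fun x => by positivity)
        (fun x => pow_le_pow_left₀ (norm_nonneg _) (hb x) 2) ?_
      refine (v.summable.abs.mul_left (C ^ 2 * (∑' y, √|v.toFun y| * ‖f y‖) ^ 2)).congr
        fun x => ?_
      rw [mul_pow, mul_pow, Real.sq_sqrt (abs_nonneg _)]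
      ring)
    (fun x y => by
      unfold birmanSchwingerKernel
      rw [v.even, v.even, ← thresholdResolvent_neg]
      congr 3
      abel)

/-- The threshold `ℰ_min(k)` is a regular point of the essential spectrum of `Ĥ_μ(k)`: the number
`1` is not an eigenvalue of the generalized Birman-Schwinger operator. -/
def IsRegularPoint {d : ℕ} (ε : C(Torus d, ℝ)) (v : PairPotential d) (μ : ℝ) (k : Torus d) :
    Prop :=
  ¬ (birmanSchwinger ε v μ k).HasEigenvalue 1

/-- The number of eigenvalues below `c`, counted with multiplicity, of an operator with real
eigenvalues: the sum over all real `z < c` of the dimension of the eigenspace of `z`. -/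
def numEigenvaluesBelow {E : Type*} [AddCommGroup E] [Module ℂ E] (T : Module.End ℂ E) (c : ℝ) :
    ℕ∞ :=
  ⨆ s : Finset (Set.Iio c), ∑ z ∈ s, Cardinal.toENat (Module.rank ℂ (T.eigenspace ((z : ℝ) : ℂ)))

end LatticePair

end

/-! The count is a Birman-Schwinger index that is stable under small perturbations. The threshold
operator `B₀ = birmanSchwinger ε v μ₀ k₀` is compact and self-adjoint. Since `1` is not an
eigenvalue, the form of `1 - B₀` has a gap: on unit vectors it is at most `-δ` on a
finite-dimensional space `V` and at least `δ` on the kernel of a linear map into `V`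
(`exists_gap_birmanSchwinger`). For `(μ, k)` near `(μ₀, k₀)` and small `s > 0`, the Birman-Schwinger
operators at distance `s` below the threshold have forms within `δ / 2` of that of `B₀`. Two
elementary inequalities (`two_mul_norm_sq_le`, `re_inner_lt_of_norm_sq_lt`) transfer the gap to the
Schrödinger operator: its form minus the threshold is nonnegative on the kernel of a map into `V`,
and negative on the nonzero part of a copy of `V`. By `numEigenvaluesBelow_eq_of_form` the count is
`dim V`, whatever `μ` and `k` are.

The analytic input is continuity up to the threshold. Because `v` is summable, operator norms of
sandwiched convolution kernels are controlled by sup norms of the kernels, hence by `L¹` norms of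
the symbols. So it suffices that `1 / (gap + s)` converges in `L¹`. This follows from uniform
convergence of the gap and a uniform bound `C r³` on the measure of `{gap ≤ r²}`
(`exists_sublevelBound_pairGap`). Near a nondegenerate minimum, strong convexity, uniform in the
quasi-momentum, bounds the diameter of a local sublevel set by a multiple of `r`; then `r ^ d ≤ r ^
3` because `d ≥ 3` and `r ≤ 1`.

The map `half` is discontinuous where the representative jumps, but only by a point `τ` with `2τ =
0`. Such a shift translates the dispersion relation by `τ`, which in position space is conjugation
by a `±1`-valued character. This is unitary and leaves the argument intact. -/

namespace LatticePair

/-! ### Counting eigenvalues by quadratic forms -/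

section SpectralCounting

variable {E : Type*} [NormedAddCommGroup E] [InnerProductSpace ℂ E]

theorem re_inner_nonneg_of_isPositive {N : E →L[ℂ] E} (hN : N.IsPositive) (x : E) :
    0 ≤ (inner ℂ x (N x)).re :=
  hN.re_inner_nonneg_right x

/-- The range of a positive operator meets its kernel trivially. -/
theorem apply_eq_zero_of_apply_apply_eq_zero {N : E →L[ℂ] E} (hN : N.IsPositive) {y : E}
    (h : N (N y) = 0) : N y = 0 := by
  have h1 : inner ℂ (N y) (N y) = inner ℂ y (N (N y)) := hN.isSymmetric y (N y)
  rw [h, inner_zero_right] at h1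
  exact inner_self_eq_zero.1 h1

/-- The dimensions of the eigenspaces of a symmetric operator below `c`, all of them contained in a
finite-dimensional invariant subspace whose eigenvalues are below `c`, add up to the dimension of
that subspace. -/
theorem numEigenvaluesBelow_eq_finrank {T : Module.End ℂ E} (hT : T.IsSymmetric) (c : ℝ)
    (R : Submodule ℂ E) [FiniteDimensional ℂ R] (hR : ∀ x ∈ R, T x ∈ R)
    (hneg : ∀ x ∈ R, x ≠ 0 → (inner ℂ x (T x)).re < c * ‖x‖ ^ 2)
    (hle : ∀ z : ℝ, z < c → T.eigenspace (z : ℂ) ≤ R) :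
    numEigenvaluesBelow T c = Module.finrank ℂ R := by
  have hTR : (T.restrict hR).IsSymmetric := hT.restrict_invariant hR
  set n := Module.finrank ℂ R with hn
  set ev := hTR.eigenvalues hn.symm with hev
  -- Each eigenspace below `c` lies in `R`, so its dimension is the multiplicity of `z` in the
  -- diagonalization of the restriction.
  have hrank : ∀ z : ℝ, z < c → Cardinal.toENat (Module.rank ℂ (T.eigenspace (z : ℂ)))
      = ((Finset.univ.filter fun i => ev i = z).card : ℕ∞) := by
    intro z hz
    have h1 : Module.End.eigenspace (T.restrict hR) (z : ℂ)
        = (T.eigenspace (z : ℂ)).comap R.subtype :=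
      Module.End.genEigenspace_restrict T R 1 (z : ℂ) hR
    have h2 : Module.rank ℂ (T.eigenspace (z : ℂ))
        = Module.rank ℂ (Module.End.eigenspace (T.restrict hR) (z : ℂ)) := by
      rw [h1]
      exact (Submodule.comapSubtypeEquivOfLe (hle z hz)).rank_eq.symm
    rw [h2, ← Module.finrank_eq_rank, ← hTR.card_filter_eigenvalues_eq hn.symm]
    simp only [map_natCast, Nat.cast_inj]
    congr 1
    ext i
    simp [hev]
  have hlt : ∀ i, ev i ∈ Set.Iio c := by
    intro i
    have h1 := hTR.hasEigenvector_eigenvectorBasis hn.symm i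
    set x := hTR.eigenvectorBasis hn.symm i with hx
    have h2 : T (x : E) = (ev i : ℂ) • (x : E) := congrArg Subtype.val h1.apply_eq_smul
    have h3 : (x : E) ≠ 0 := fun h => h1.2 (Subtype.ext h)
    have h4 := hneg x x.2 h3
    rw [h2, inner_smul_right, inner_self_eq_norm_sq_to_K] at h4
    have h5 : (((ev i : ℂ) * ((‖(x : E)‖ : ℂ)) ^ 2)).re = ev i * ‖(x : E)‖ ^ 2 := by
      norm_cast
    have h6 : ev i * ‖(x : E)‖ ^ 2 < c * ‖(x : E)‖ ^ 2 := h5 ▸ h4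
    exact Set.mem_Iio.2 <| lt_of_mul_lt_mul_right h6 (by positivity)
  have hsum : ∀ s : Finset (Set.Iio c),
      ∑ z ∈ s, Cardinal.toENat (Module.rank ℂ (T.eigenspace (((z : Set.Iio c) : ℝ) : ℂ)))
        = ((Finset.univ.filter fun i => (⟨ev i, hlt i⟩ : Set.Iio c) ∈ s).card : ℕ∞) := by
    intro s
    rw [Finset.sum_congr rfl fun (z : Set.Iio c) _ => hrank (z : ℝ) z.2, ← Nat.cast_sum, Nat.cast_inj]
    rw [Finset.card_eq_sum_card_fiberwise (f := fun i => (⟨ev i, hlt i⟩ : Set.Iio c)) (t := s)]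
    · refine Finset.sum_congr rfl fun z hz => ?_
      congr 1
      ext i
      simp only [Finset.mem_filter, Finset.mem_univ, true_and, Subtype.ext_iff]
      constructor
      · intro h
        refine ⟨?_, h⟩
        convert hz
      · exact fun h => h.2
    · intro i hi
      simpa using hi
  unfold numEigenvaluesBelow
  apply le_antisymm
  · refine iSup_le fun s => ?_
    rw [hsum, Nat.cast_le]
    exact (Finset.card_filter_le _ _).trans (by simp)
  -- The supremum is attained at the finite set of all eigenvalues of the restriction.
  · refine le_trans ?_ (le_iSup _ (Finset.univ.image fun i => (⟨ev i, hlt i⟩ : Set.Iio c)))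
    rw [hsum]
    simp

variable [CompleteSpace E]

/-- A positive operator satisfies `‖N x‖² ≤ C ⟨x, N x⟩`. -/
theorem exists_norm_sq_le_of_isPositive (N : E →L[ℂ] E) (hN : N.IsPositive) :
    ∃ C : ℝ, 0 ≤ C ∧ ∀ x, ‖N x‖ ^ 2 ≤ C * (inner ℂ x (N x)).re := by
  -- With `N = S* S` one has `⟨x, N x⟩ = ‖S x‖²` and `‖N x‖ ≤ ‖S*‖ ‖S x‖`.
  obtain ⟨S, hS⟩ := CStarAlgebra.nonneg_iff_eq_star_mul_self.1
    ((ContinuousLinearMap.nonneg_iff_isPositive N).2 hN)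
  have h1 : ∀ x, N x = (ContinuousLinearMap.adjoint S) (S x) := fun x => by
    rw [hS]; rfl
  refine ⟨‖ContinuousLinearMap.adjoint S‖ ^ 2, by positivity, fun x => ?_⟩
  have h2 : (inner ℂ x (N x)).re = ‖S x‖ ^ 2 := by
    rw [h1, ContinuousLinearMap.adjoint_inner_right, inner_self_eq_norm_sq_to_K]
    norm_cast
  rw [h2, h1, ← mul_pow]
  exact pow_le_pow_left₀ (norm_nonneg _) (ContinuousLinearMap.le_opNorm _ _) 2

/-- The positive and negative parts of a bounded self-adjoint operator. -/
theorem exists_isPositive_sub_isPositive (T : E →L[ℂ] E) (hT : IsSelfAdjoint T) :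
    ∃ P N : E →L[ℂ] E, P.IsPositive ∧ N.IsPositive ∧ (∀ x, T x = P x - N x) ∧
      (∀ x, P (N x) = 0) ∧ ∀ x, N (P x) = 0 := by
  refine ⟨T⁺, T⁻, (ContinuousLinearMap.nonneg_iff_isPositive _).1 (CFC.posPart_nonneg T),
    (ContinuousLinearMap.nonneg_iff_isPositive _).1 (CFC.negPart_nonneg T), fun x => ?_,
    fun x => ?_, fun x => ?_⟩
  · exact (DFunLike.congr_fun (CFC.posPart_sub_negPart T hT) x).symm
  · exact DFunLike.congr_fun (CFC.posPart_mul_negPart T) x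
  · exact DFunLike.congr_fun (CFC.negPart_mul_posPart T) x

/-- The number of eigenvalues below `c` is the dimension of a maximal subspace on which the
quadratic form of `T - c` is negative. -/
theorem numEigenvaluesBelow_eq_of_form {V : Type*} [AddCommGroup V] [Module ℂ V]
    [FiniteDimensional ℂ V] {T : Module.End ℂ E} (hT : T.IsSymmetric) (c : ℝ)
    (Φ : E →ₗ[ℂ] V) (Ψ : V →ₗ[ℂ] E)
    (hΦ : ∀ x, Φ x = 0 → c * ‖x‖ ^ 2 ≤ (inner ℂ x (T x)).re)
    (hΨ : ∀ y, y ≠ 0 → (inner ℂ (Ψ y) (T (Ψ y))).re < c * ‖Ψ y‖ ^ 2) :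
    numEigenvaluesBelow T c = Module.finrank ℂ V := by
  have hTs : (T - (c : ℂ) • 1).IsSymmetric := by
    refine hT.sub ?_
    intro x y
    change inner ℂ ((c : ℂ) • x) y = inner ℂ x ((c : ℂ) • y)
    rw [inner_smul_left, inner_smul_right, Complex.conj_ofReal]
  -- Hellinger-Toeplitz: a symmetric operator defined everywhere is bounded.
  let A : E →L[ℂ] E := ⟨T - (c : ℂ) • 1, hTs.continuous⟩
  have hA : ∀ x, A x = T x - (c : ℂ) • x := fun x => rfl
  have hAs : IsSelfAdjoint A := ContinuousLinearMap.isSelfAdjoint_iff_isSymmetric.2 hTs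
  have hAin : ∀ x, (inner ℂ x (A x)).re = (inner ℂ x (T x)).re - c * ‖x‖ ^ 2 := by
    intro x
    rw [hA, inner_sub_right, inner_smul_right, inner_self_eq_norm_sq_to_K, Complex.sub_re]
    congr 1
    rw [← Complex.ofReal_re (c * ‖x‖ ^ 2)]
    push_cast
    rfl
  obtain ⟨P, N, hP, hN, hsub, hPN, hNP⟩ := exists_isPositive_sub_isPositive A hAs
  have hNz : ∀ x, (inner ℂ x (N x)).re ≤ 0 → N x = 0 := by
    intro x hx
    obtain ⟨C, hC, h⟩ := exists_norm_sq_le_of_isPositive N hN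
    have h1 := h x
    have h2 : ‖N x‖ ^ 2 ≤ 0 := h1.trans (mul_nonpos_of_nonneg_of_nonpos hC hx)
    simpa using le_antisymm h2 (by positivity)
  let R : Submodule ℂ E := N.range
  have hRneg : ∀ x ∈ R, x ≠ 0 → (inner ℂ x (A x)).re < 0 := by
    rintro _ ⟨y, rfl⟩ hy
    by_contra! h
    change 0 ≤ (inner ℂ (N y) (A (N y))).re at h
    rw [hsub, hPN, zero_sub, inner_neg_right, Complex.neg_re] at h
    exact hy (apply_eq_zero_of_apply_apply_eq_zero hN (hNz _ (by linarith)))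
  -- The form of `A` is negative on the range of `N` and nonnegative on the kernel of `Φ`, so these
  -- meet only in `0`. This gives `dim R ≤ dim V`, and finiteness of `R` comes with it.
  have hinj : Function.Injective (Φ ∘ₗ R.subtype) := by
    rw [← LinearMap.ker_eq_bot, LinearMap.ker_eq_bot']
    intro x hx
    by_contra hx0
    have h1 := hRneg x x.2 (fun h => hx0 (Subtype.ext h))
    have h2 := hΦ x hx
    rw [hAin] at h1
    linarith
  have hfin : FiniteDimensional ℂ R := FiniteDimensional.of_injective _ hinj
  -- On the kernel of `N` the form of `A` is that of `P`, hence nonnegative, which excludes `Ψ y`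
  -- with `y ≠ 0`. So `dim V ≤ dim R`.
  have hinj2 : Function.Injective (N.toLinearMap.rangeRestrict ∘ₗ Ψ) := by
    rw [← LinearMap.ker_eq_bot, LinearMap.ker_eq_bot']
    intro y hy
    by_contra hy0
    have h1 : N (Ψ y) = 0 := congrArg Subtype.val hy
    have h2 := hΨ y hy0
    have h3 := hAin (Ψ y)
    rw [hsub, h1, sub_zero] at h3
    have h4 := re_inner_nonneg_of_isPositive hP (Ψ y)
    linarith
  have hdim : Module.finrank ℂ R = Module.finrank ℂ V :=
    le_antisymm (LinearMap.finrank_le_finrank_of_injective hinj)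
      (LinearMap.finrank_le_finrank_of_injective hinj2)
  rw [← hdim]
  have hTA : ∀ x, T x = A x + (c : ℂ) • x := fun x => by rw [hA]; simp
  refine numEigenvaluesBelow_eq_finrank hT c R ?_ ?_ ?_
  · rintro _ ⟨y, rfl⟩
    change T (N y) ∈ R
    rw [hTA, hsub, hPN, zero_sub]
    exact R.add_mem (R.neg_mem ⟨N y, rfl⟩) (R.smul_mem _ ⟨y, rfl⟩)
  · intro x hx hx0
    have h1 := hRneg x hx hx0
    rw [hAin] at h1
    linarith
  · intro z hz x hx
    rw [Module.End.mem_eigenspace_iff] at hx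
    have h1 : A x = ((z - c : ℝ) : ℂ) • x := by
      rw [hA, hx, ← sub_smul]
      push_cast
      rfl
    rw [hsub] at h1
    -- `P` would have the negative eigenvalue `z - c` at `P x`; hence `P x = 0` and `x` is a
    -- multiple of `N x`.
    have h2 : P (P x) = ((z - c : ℝ) : ℂ) • P x := by
      have := congrArg P h1
      rwa [map_sub, hPN, sub_zero, map_smul] at this
    have h3 := re_inner_nonneg_of_isPositive hP (P x)
    rw [h2, inner_smul_right, inner_self_eq_norm_sq_to_K] at h3
    have h4 : 0 ≤ (z - c) * ‖P x‖ ^ 2 := by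
      have : ((((z - c : ℝ) : ℂ)) * ((‖P x‖ : ℂ)) ^ 2).re = (z - c) * ‖P x‖ ^ 2 := by
        norm_cast
      exact this ▸ h3
    have h5 : P x = 0 := by
      by_contra h
      have : 0 < ‖P x‖ ^ 2 := by positivity
      nlinarith
    rw [h5, zero_sub] at h1
    have hc : ((z - c : ℝ) : ℂ) ≠ 0 := by
      norm_cast
      linarith
    have h6 : x = (((z - c : ℝ) : ℂ))⁻¹ • (-N x) := by
      rw [h1, smul_smul, inv_mul_cancel₀ hc, one_smul]
    rw [h6]
    exact R.smul_mem _ (R.neg_mem ⟨x, rfl⟩)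

/-- If `1` is not an eigenvalue of a symmetric compact operator `B`, the quadratic form of `1 - B`
is uniformly negative on a finite-dimensional subspace and uniformly positive on a complement. -/
theorem exists_gap_of_not_hasEigenvalue_one {B : E →L[ℂ] E} (hB : B.IsSymmetric)
    (hc : IsCompactOperator B) (h1 : ¬ Module.End.HasEigenvalue (B : Module.End ℂ E) 1) :
    ∃ (V : Submodule ℂ E) (S : E →ₗ[ℂ] V) (δ : ℝ), FiniteDimensional ℂ V ∧ 0 < δ ∧
      (∀ x, S x = 0 → δ * ‖x‖ ^ 2 ≤ ‖x‖ ^ 2 - (inner ℂ x (B x)).re) ∧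
      ∀ x ∈ V, δ * ‖x‖ ^ 2 ≤ (inner ℂ x (B x)).re - ‖x‖ ^ 2 := by
  -- Fredholm alternative: `1 - B` is bounded below.
  obtain ⟨K, hK⟩ := hc.antilipschitz_of_not_hasEigenvalue one_ne_zero h1
  set A : E →L[ℂ] E := 1 - B with hAdef
  have hA : ∀ x, A x = x - B x := fun x => rfl
  have hAs : IsSelfAdjoint A := by
    refine IsSelfAdjoint.sub (IsSelfAdjoint.one _) ?_
    exact ContinuousLinearMap.isSelfAdjoint_iff_isSymmetric.2 hB
  have hbelow : ∀ x, ‖x‖ ≤ K * ‖A x‖ := by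
    intro x
    have h := hK.le_mul_dist x 0
    simp only [dist_zero_right, map_zero] at h
    refine h.trans_eq ?_
    rw [hA, norm_sub_rev]
    simp
  have hAin : ∀ x, (inner ℂ x (A x)).re = ‖x‖ ^ 2 - (inner ℂ x (B x)).re := by
    intro x
    rw [hA, inner_sub_right, inner_self_eq_norm_sq_to_K, Complex.sub_re]
    congr 1
    norm_cast
  obtain ⟨P, N, hP, hN, hsub, hPN, hNP⟩ := exists_isPositive_sub_isPositive A hAs
  obtain ⟨C₁, hC₁, hCP⟩ := exists_norm_sq_le_of_isPositive P hP
  obtain ⟨C₂, hC₂, hCN⟩ := exists_norm_sq_le_of_isPositive N hN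
  -- One constant serves both spectral halves; the summand `1` keeps it invertible. The gap is
  -- `C⁻¹`.
  set C := (K : ℝ) ^ 2 * (C₁ + C₂) + 1 with hCdef
  have hC : 0 < C := by positivity
  have key : ∀ x r : ℝ, 0 ≤ r → x ≤ (K : ℝ) ^ 2 * (C₁ * r) ∨ x ≤ (K : ℝ) ^ 2 * (C₂ * r) →
      C⁻¹ * x ≤ r := by
    intro x r hr h
    rw [inv_mul_le_iff₀ hC]
    have h3 : 0 ≤ (K : ℝ) ^ 2 * (C₁ * r) := by positivity
    have h4 : 0 ≤ (K : ℝ) ^ 2 * (C₂ * r) := by positivity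
    have h5 : C * r = (K : ℝ) ^ 2 * (C₁ * r) + (K : ℝ) ^ 2 * (C₂ * r) + r := by
      rw [hCdef]; ring
    rcases h with h | h <;> linarith
  have hsq : ∀ x, ‖x‖ ^ 2 ≤ (K : ℝ) ^ 2 * ‖A x‖ ^ 2 := fun x => by
    rw [← mul_pow]
    exact pow_le_pow_left₀ (norm_nonneg _) (hbelow x) 2
  have hVneg : ∀ x ∈ P.ker, C⁻¹ * ‖x‖ ^ 2 ≤ (inner ℂ x (B x)).re - ‖x‖ ^ 2 := by
    intro x hx
    have hx0 : P x = 0 := hx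
    have h2 : A x = -N x := by rw [hsub, hx0, zero_sub]
    have h3 := hAin x
    rw [h2, inner_neg_right, Complex.neg_re] at h3
    refine (key _ _ (re_inner_nonneg_of_isPositive hN x) (Or.inr ?_)).trans (by linarith)
    refine (hsq x).trans ?_
    rw [h2, norm_neg]
    exact mul_le_mul_of_nonneg_left (hCN _) (by positivity)
  -- On the kernel of `P` one has `⟨x, B x⟩ ≥ ‖x‖²`, so the compact operator `B` is bounded below
  -- there. The preimage of a compact set is then a compact neighbourhood of `0`, and Riesz's
  -- theorem gives finite dimension.
  have hle : ∀ x ∈ P.ker, ‖x‖ ≤ ‖B x‖ := by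
    intro x hx
    have h2 := hVneg x hx
    have h3 : 0 ≤ C⁻¹ * ‖x‖ ^ 2 := by positivity
    have h4 : (inner ℂ x (B x)).re ≤ ‖x‖ * ‖B x‖ :=
      (Complex.re_le_norm _).trans (norm_inner_le_norm _ _)
    by_contra! h5
    have h6 : 0 < ‖x‖ := (norm_nonneg _).trans_lt h5
    nlinarith
  have hfin : FiniteDimensional ℂ P.ker := by
    have hcl : CompleteSpace P.ker := P.isClosed_ker.completeSpace_coe
    let j : P.ker →L[ℂ] E := B.comp P.ker.subtypeL
    have hj : AntilipschitzWith 1 j := by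
      refine ContinuousLinearMap.antilipschitz_of_bound _ fun x => ?_
      rw [NNReal.coe_one, one_mul]
      exact hle x x.2
    obtain ⟨Q, hQ, hQ0⟩ := hc.comp_clm P.ker.subtypeL
    refine FiniteDimensional.of_isCompactOperator_id (𝕜 := ℂ)
      ⟨j ⁻¹' Q, (hj.isClosedEmbedding j.uniformContinuous).isCompact_preimage hQ, hQ0⟩
  -- The map `S` is `N` itself, which takes values in the kernel of `P` because `P N = 0`.
  refine ⟨P.ker, N.toLinearMap.codRestrict _ hPN, C⁻¹, hfin, by positivity, fun x hx => ?_, hVneg⟩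
  have hx0 : N x = 0 := congrArg Subtype.val hx
  have h2 : A x = P x := by rw [hsub, hx0, sub_zero]
  rw [← hAin, h2]
  refine key _ _ (re_inner_nonneg_of_isPositive hP x) (Or.inl ?_)
  refine (hsq x).trans ?_
  rw [h2]
  exact mul_le_mul_of_nonneg_left (hCP _) (by positivity)

end SpectralCounting

/-! ### Compactness by finite-rank approximation -/

section CompactOperators

variable {E : Type*} [NormedAddCommGroup E] [NormedSpace ℂ E]

theorem isCompactOperator_comp_of_finiteDimensional_range (T Q : E →L[ℂ] E)
    [FiniteDimensional ℂ Q.range] : IsCompactOperator (T ∘L Q) := by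
  let j : E →L[ℂ] Q.range := Q.codRestrict Q.range fun x => ⟨x, rfl⟩
  have : ProperSpace Q.range := FiniteDimensional.proper ℂ Q.range
  have h : IsCompactOperator j :=
    isCompactOperator_of_locallyCompactSpace_dom j
  exact h.clm_comp (T ∘L Q.range.subtypeL)

theorem isCompactOperator_of_norm_sub_le [CompleteSpace E] {ι : Type*} {l : Filter ι} [l.NeBot]
    {F : ι → E →L[ℂ] E} {T : E →L[ℂ] E} {r : ι → ℝ} (hr : Filter.Tendsto r l (nhds 0))
    (hr0 : ∀ i, 0 ≤ r i) (hF : ∀ i x, ‖F i x - T x‖ ≤ r i * ‖x‖)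
    (hc : ∀ i, IsCompactOperator (F i)) : IsCompactOperator T := by
  refine isCompactOperator_of_tendsto (l := l) (F := F) ?_ (Filter.Eventually.of_forall hc)
  rw [tendsto_iff_norm_sub_tendsto_zero]
  exact squeeze_zero (fun _ => norm_nonneg _)
    (fun i => ContinuousLinearMap.opNorm_le_bound _ (hr0 i) (hF i)) hr

end CompactOperators

/-! ### Kernel operators on even square-summable functions -/

section Kernels

variable {d : ℕ}

theorem summable_norm_sq (f : L2 d) : Summable fun y => ‖f y‖ ^ 2 := by
  simpa using (memℓp_gen_iff (p := 2) (by norm_num)).1 (lp.memℓp f)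

theorem norm_sq_eq_tsum (f : L2 d) : ‖f‖ ^ 2 = ∑' y, ‖f y‖ ^ 2 := by
  simpa using lp.norm_rpow_eq_tsum (p := 2) (by norm_num) f

theorem isClosed_evenL2 : IsClosed (evenL2 d : Set (L2 d)) := by
  have h : (evenL2 d : Set (L2 d)) = ⋂ x, {f : L2 d | f (-x) = f x} := by
    ext f
    simp only [Set.mem_iInter]
    rfl
  rw [h]
  exact isClosed_iInter fun x => isClosed_eq
    (lp.evalCLM ℂ (fun _ : Lattice d => ℂ) 2 (-x)).continuous
    (lp.evalCLM ℂ (fun _ : Lattice d => ℂ) 2 x).continuous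

instance : CompleteSpace (evenL2 d) := isClosed_evenL2.completeSpace_coe

/-- Cauchy-Schwarz for `∑ b ‖f‖`. -/
theorem tsum_mul_norm_le {b : Lattice d → ℝ} (hb0 : ∀ y, 0 ≤ b y) (hb : Summable fun y => b y ^ 2)
    (f : L2 d) : (Summable fun y => b y * ‖f y‖) ∧
      ∑' y, b y * ‖f y‖ ≤ √(∑' y, b y ^ 2) * ‖f‖ := by
  have hf := summable_norm_sq f
  constructor
  · refine Summable.of_nonneg_of_le (fun y => mul_nonneg (hb0 y) (norm_nonneg _)) (fun y => ?_)
      (hb.add hf)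
    nlinarith [sq_nonneg (b y - ‖f y‖), sq_nonneg (b y), sq_nonneg ‖f y‖]
  · have h := Real.inner_le_Lp_mul_Lq_tsum_of_nonneg Real.HolderConjugate.two_two hb0
      (fun y => norm_nonneg (f y)) (by simpa using hb) (by simpa using hf)
    simp only [Real.rpow_ofNat] at h
    rw [← norm_sq_eq_tsum, ← Real.sqrt_eq_rpow, ← Real.sqrt_eq_rpow,
      Real.sqrt_sq (norm_nonneg _)] at h
    exact h

/-- A kernel dominated by a product of square-summable functions defines a bounded operator. -/
theorem norm_le_of_kernel_le {a b : Lattice d → ℝ} (ha0 : ∀ y, 0 ≤ a y)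
    (ha : Summable fun y => a y ^ 2) (hb0 : ∀ y, 0 ≤ b y) (hb : Summable fun y => b y ^ 2)
    {K : Lattice d → Lattice d → ℂ} (hK : ∀ x y, ‖K x y‖ ≤ a x * b y) {f g : L2 d}
    (hg : ∀ x, g x = ∑' y, K x y * f y) :
    ‖g‖ ≤ √(∑' y, a y ^ 2) * √(∑' y, b y ^ 2) * ‖f‖ := by
  obtain ⟨hs, hle⟩ := tsum_mul_norm_le hb0 hb f
  set M := √(∑' y, b y ^ 2) * ‖f‖ with hM
  have hM0 : 0 ≤ M := by positivity
  have h1 : ∀ x, ‖g x‖ ≤ a x * M := by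
    intro x
    rw [hg]
    refine (tsum_of_norm_bounded (hs.hasSum.mul_left (a x)) fun y => ?_).trans
      (mul_le_mul_of_nonneg_left hle (ha0 x))
    rw [norm_mul, ← mul_assoc]
    exact mul_le_mul_of_nonneg_right (hK x y) (norm_nonneg _)
  have h2 : ‖g‖ ^ 2 ≤ (∑' y, a y ^ 2) * M ^ 2 := by
    rw [norm_sq_eq_tsum, ← tsum_mul_right]
    refine (summable_norm_sq g).tsum_le_tsum (fun x => ?_) (ha.mul_right _)
    rw [← mul_pow]
    exact pow_le_pow_left₀ (norm_nonneg _) (h1 x) 2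
  rw [mul_assoc, ← hM]
  refine le_of_sq_le_sq ?_ (by positivity)
  rw [mul_pow, Real.sq_sqrt (tsum_nonneg fun y => by positivity)]
  exact h2

/-- Multiplication by a bounded even function on the lattice. -/
noncomputable def diag (w : Lattice d → ℝ) (hb : ∃ C, ∀ x, |w x| ≤ C) (he : ∀ x, w (-x) = w x) :
    Module.End ℂ (evenL2 d) where
  toFun f := ⟨⟨fun x => (w x : ℂ) * (f : L2 d) x, by
    obtain ⟨C, hC⟩ := hb
    refine (((lp.memℓp (f : L2 d)).norm).const_smul C).mono fun x => ?_
    rw [Pi.smul_apply, smul_eq_mul, norm_mul, Complex.norm_real, Real.norm_eq_abs]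
    exact mul_le_mul_of_nonneg_right (hC x) (norm_nonneg _)⟩, by
    intro x
    have h := f.2 x
    change (w (-x) : ℂ) * (f : L2 d) (-x) = (w x : ℂ) * (f : L2 d) x
    rw [he, h]⟩
  map_add' f g := by
    apply Subtype.ext
    apply lp.ext
    funext x
    exact mul_add _ _ _
  map_smul' c f := by
    apply Subtype.ext
    apply lp.ext
    funext x
    exact mul_left_comm _ _ _

theorem diag_apply (w : Lattice d → ℝ) (hb : ∃ C, ∀ x, |w x| ≤ C) (he : ∀ x, w (-x) = w x)
    (f : evenL2 d) (x : Lattice d) : (diag w hb he f : L2 d) x = (w x : ℂ) * (f : L2 d) x := rfl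

theorem evenL2_ext {f g : evenL2 d} (h : ∀ x, (f : L2 d) x = (g : L2 d) x) : f = g := by
  apply Subtype.ext
  apply lp.ext
  funext x
  exact h x

theorem inner_evenL2 (f g : evenL2 d) :
    inner ℂ f g = ∑' x, inner ℂ ((f : L2 d) x) ((g : L2 d) x) :=
  lp.inner_eq_tsum (f : L2 d) (g : L2 d)

theorem diag_isSymmetric (w : Lattice d → ℝ) (hb : ∃ C, ∀ x, |w x| ≤ C)
    (he : ∀ x, w (-x) = w x) : (diag w hb he).IsSymmetric := by
  intro f g
  rw [inner_evenL2, inner_evenL2]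
  refine tsum_congr fun x => ?_
  simp only [diag_apply, RCLike.inner_apply, map_mul, Complex.conj_ofReal]
  ring

/-- An operator with a kernel dominated by a product of square-summable functions is compact. -/
theorem isCompactOperator_of_kernel_le {a b : Lattice d → ℝ} (ha0 : ∀ y, 0 ≤ a y)
    (ha : Summable fun y => a y ^ 2) (hb0 : ∀ y, 0 ≤ b y) (hb : Summable fun y => b y ^ 2)
    {K : Lattice d → Lattice d → ℂ} (hK : ∀ x y, ‖K x y‖ ≤ a x * b y)
    (T : evenL2 d →L[ℂ] evenL2 d)
    (hT : ∀ f x, (T f : L2 d) x = ∑' y, K x y * (f : L2 d) y) : IsCompactOperator T := by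
  classical
  -- The cutoff is to `s ∪ -s`, so that it preserves even functions.
  let w : Finset (Lattice d) → Lattice d → ℝ := fun s x => if x ∈ s ∪ s.image Neg.neg then 1 else 0
  have hwb : ∀ s, ∃ C, ∀ x, |w s x| ≤ C := fun s => ⟨1, fun x => by
    simp only [w]
    split_ifs <;> simp⟩
  have hwe : ∀ s x, w s (-x) = w s x := by
    intro s x
    simp only [w, Finset.mem_union, Finset.mem_image]
    congr 1
    apply propext
    constructor
    · rintro (h | ⟨y, h, hy⟩)
      · exact Or.inr ⟨-x, h, neg_neg x⟩
      · exact Or.inl (by rwa [← neg_inj.1 hy])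
    · rintro (h | ⟨y, h, hy⟩)
      · exact Or.inr ⟨x, h, rfl⟩
      · exact Or.inl (by rwa [← hy, neg_neg])
  let Q : Finset (Lattice d) → evenL2 d →L[ℂ] evenL2 d := fun s =>
    ⟨diag (w s) (hwb s) (hwe s), (diag_isSymmetric _ _ _).continuous⟩
  have hQ : ∀ s f x, (Q s f : L2 d) x = (w s x : ℂ) * (f : L2 d) x := fun s f x => rfl
  have hfin : ∀ s, FiniteDimensional ℂ (Q s).range := by
    intro s
    let r : (Q s).range →ₗ[ℂ] ((s ∪ s.image Neg.neg : Finset (Lattice d)) → ℂ) :=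
      { toFun := fun f x => ((f : evenL2 d) : L2 d) x
        map_add' := fun f g => rfl
        map_smul' := fun c f => rfl }
    refine FiniteDimensional.of_injective r ?_
    rw [← LinearMap.ker_eq_bot, LinearMap.ker_eq_bot']
    rintro ⟨_, f, rfl⟩ hf
    apply Subtype.ext
    refine evenL2_ext fun x => ?_
    change (Q s f : L2 d) x = 0
    by_cases hx : x ∈ s ∪ s.image Neg.neg
    · exact congrFun hf ⟨x, hx⟩
    · rw [hQ]
      simp only [w, if_neg hx, Complex.ofReal_zero, zero_mul]
  have hcomp : ∀ s, IsCompactOperator (T ∘L Q s) := by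
    intro s
    have := hfin s
    exact isCompactOperator_comp_of_finiteDimensional_range T (Q s)
  have hlim : Filter.Tendsto (fun s : Finset (Lattice d) =>
      √(∑' y, a y ^ 2) * √(∑' y : {y // y ∉ s}, b y ^ 2)) Filter.atTop (nhds 0) := by
    have h := ((Real.continuous_sqrt.tendsto 0).comp
      (tendsto_tsum_compl_atTop_zero fun y => b y ^ 2)).const_mul (√(∑' y, a y ^ 2))
    simpa using h
  refine isCompactOperator_of_norm_sub_le hlim (fun _ => by positivity) (fun s f => ?_) hcomp
  have hsub : (T ∘L Q s) f - T f = T (Q s f - f) := by simp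
  -- The kernel of `T Q_s - T` vanishes for `y ∈ s`, so it is dominated by `a` times the tail of
  -- `b`, whose `ℓ²` norm tends to `0`.
  let b' : Lattice d → ℝ := Set.indicator {y | y ∉ s} b
  have hb' : (fun y => b' y ^ 2) = Set.indicator {y | y ∉ s} fun y => b y ^ 2 := by
    funext y
    simp only [b', Set.indicator_apply]
    split_ifs <;> simp
  have hb's : Summable fun y => b' y ^ 2 := by
    rw [hb']
    exact hb.indicator _
  have hbt : ∑' y : {y // y ∉ s}, b y ^ 2 = ∑' y, b' y ^ 2 := by
    rw [hb']
    exact tsum_subtype {y | y ∉ s} fun y => b y ^ 2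
  rw [hsub, hbt]
  refine norm_le_of_kernel_le (K := fun x y => K x y * ((w s y : ℂ) - 1)) ha0 ha
    (fun y => Set.indicator_nonneg (fun y _ => hb0 y) y) hb's (fun x y => ?_) (f := (f : L2 d))
    (g := (T (Q s f - f) : L2 d)) (fun x => ?_)
  · by_cases hy : y ∈ s
    · have : w s y = 1 := by simp [w, hy]
      rw [this]
      simp [hy]
    · have h1 : b' y = b y := by simp [b', hy]
      have h2 : ‖((w s y : ℂ) - 1)‖ ≤ 1 := by
        simp only [w]
        split_ifs <;> simp
      change _ ≤ a x * b' y
      rw [h1, norm_mul]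
      exact (mul_le_of_le_one_right (norm_nonneg _) h2).trans (hK x y)
  · rw [hT]
    refine tsum_congr fun y => ?_
    change K x y * ((Q s f : L2 d) y - (f : L2 d) y) = _
    rw [hQ]
    ring

end Kernels

/-! ### Fourier multipliers -/

section Multipliers

variable {d : ℕ}

theorem memLp_mul (g : C(Torus d, ℝ)) (F : Lp ℂ 2 (haar d)) :
    MemLp (fun p => (g p : ℂ) * F p) 2 (haar d) := by
  refine MemLp.of_le_mul (c := ‖g‖) (Lp.memLp F)
    ((by fun_prop : Continuous fun p => (g p : ℂ)).aestronglyMeasurable.mul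
      (Lp.aestronglyMeasurable F)) (Filter.Eventually.of_forall fun p => ?_)
  rw [norm_mul, Complex.norm_real]
  exact mul_le_mul_of_nonneg_right (g.norm_coe_le_norm p) (norm_nonneg _)

/-- Multiplication by a continuous function on `L²` of the torus. -/
noncomputable def lpMul (g : C(Torus d, ℝ)) : Lp ℂ 2 (haar d) →ₗ[ℂ] Lp ℂ 2 (haar d) where
  toFun F := MemLp.toLp (fun p => (g p : ℂ) * F p) (memLp_mul g F)
  map_add' F G := by
    rw [← MemLp.toLp_add, MemLp.toLp_eq_toLp_iff]
    filter_upwards [Lp.coeFn_add F G] with p hp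
    rw [hp]
    exact mul_add _ _ _
  map_smul' c F := by
    rw [RingHom.id_apply, ← MemLp.toLp_const_smul, MemLp.toLp_eq_toLp_iff]
    filter_upwards [Lp.coeFn_smul c F] with p hp
    rw [hp]
    exact mul_left_comm _ _ _

theorem coeFn_lpMul (g : C(Torus d, ℝ)) (F : Lp ℂ 2 (haar d)) :
    lpMul g F =ᵐ[haar d] fun p => (g p : ℂ) * F p :=
  MemLp.coeFn_toLp (memLp_mul g F)

/-- The Fourier transform `ℓ²(ℤᵈ) ≃ L²(𝕋ᵈ)`, as an orthonormal basis. -/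
noncomputable def fourierBasis (d : ℕ) : HilbertBasis (Lattice d) ℂ (Lp ℂ 2 (haar d)) :=
  UnitAddTorus.mFourierBasis

theorem fourierBasis_apply (x : Lattice d) :
    fourierBasis d x = ContinuousMap.toLp (E := ℂ) 2 (haar d) ℂ (UnitAddTorus.mFourier x) :=
  congrFun UnitAddTorus.coe_mFourierBasis x

/-- The operator on `ℓ²(ℤᵈ)` which is multiplication by `g` in momentum space. -/
noncomputable def multiplier (g : C(Torus d, ℝ)) : L2 d →ₗ[ℂ] L2 d :=
  (fourierBasis d).repr.toLinearEquiv.toLinearMap ∘ₗ lpMul g ∘ₗ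
    (fourierBasis d).repr.symm.toLinearEquiv.toLinearMap

theorem multiplier_apply (g : C(Torus d, ℝ)) (f : L2 d) :
    multiplier g f = (fourierBasis d).repr (lpMul g ((fourierBasis d).repr.symm f)) := rfl

/-- The Fourier coefficients of a continuous function. -/
noncomputable def symbolCoeff (g : C(Torus d, ℝ)) (x : Lattice d) : ℂ :=
  ∫ p, UnitAddTorus.mFourier (-x) p * (g p : ℂ) ∂haar d

/-- Parseval's identity: as `g` is real, the coefficient at `x` of `g F` is the inner product of `g`
times the character of `x` with `F`, and expanding this in the Fourier basis yields the convolution.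
It identifies the free operator with multiplication by the dispersion relation. -/
theorem hasSum_multiplier (g : C(Torus d, ℝ)) (f : L2 d) (x : Lattice d) :
    HasSum (fun s => symbolCoeff g (x - s) * f s) (multiplier g f x) := by
  let e : C(Torus d, ℂ) := ⟨fun p => (g p : ℂ), by fun_prop⟩
  have he : ∀ p, (starRingEnd ℂ) (e p) = e p := fun p => Complex.conj_ofReal _
  set F : Lp ℂ 2 (haar d) := (fourierBasis d).repr.symm f with hF
  let A : C(Torus d, ℂ) := e * UnitAddTorus.mFourier x
  have key := (fourierBasis d).hasSum_inner_mul_inner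
    (ContinuousMap.toLp (E := ℂ) 2 (haar d) ℂ A) F
  have h1 : multiplier g f x = inner ℂ (ContinuousMap.toLp (E := ℂ) 2 (haar d) ℂ A) F := by
    rw [multiplier_apply, HilbertBasis.repr_apply_apply, fourierBasis_apply, L2.inner_def,
      L2.inner_def]
    refine integral_congr_ae ?_
    filter_upwards [ContinuousMap.coeFn_toLp (𝕜 := ℂ) (p := 2) (haar d) A, coeFn_lpMul g F,
      ContinuousMap.coeFn_toLp (𝕜 := ℂ) (p := 2) (haar d) (UnitAddTorus.mFourier x)]
      with p hp1 hp2 hp3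
    rw [hp1, hp2, hp3]
    simp only [RCLike.inner_apply, A, ContinuousMap.mul_apply, map_mul, he]
    simp only [e, ContinuousMap.coe_mk]
    ring
  rw [h1]
  refine key.congr_fun fun s => ?_
  have h2 : inner ℂ (fourierBasis d s) F = f s := by
    rw [← HilbertBasis.repr_apply_apply]
    simp [F]
  rw [h2, fourierBasis_apply, ContinuousMap.inner_toLp]
  congr 1
  unfold symbolCoeff
  refine integral_congr_ae (Filter.Eventually.of_forall fun p => ?_)
  simp only [A, ContinuousMap.mul_apply, map_mul, he]
  rw [neg_sub, sub_eq_add_neg, UnitAddTorus.mFourier_add, UnitAddTorus.mFourier_neg]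
  simp only [e, ContinuousMap.coe_mk]
  ring

theorem multiplier_mul (g h : C(Torus d, ℝ)) (f : L2 d) :
    multiplier (g * h) f = multiplier g (multiplier h f) := by
  simp only [multiplier_apply, LinearIsometryEquiv.symm_apply_apply]
  congr 1
  apply Lp.ext
  filter_upwards [coeFn_lpMul (g * h) ((fourierBasis d).repr.symm f),
    coeFn_lpMul g (lpMul h ((fourierBasis d).repr.symm f)),
    coeFn_lpMul h ((fourierBasis d).repr.symm f)] with p h1 h2 h3
  rw [h1, h2, h3, ContinuousMap.mul_apply, Complex.ofReal_mul, mul_assoc]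

theorem multiplier_const (c : ℝ) (f : L2 d) :
    multiplier (ContinuousMap.const _ c) f = (c : ℂ) • f := by
  have h : lpMul (ContinuousMap.const _ c) ((fourierBasis d).repr.symm f)
      = (c : ℂ) • (fourierBasis d).repr.symm f := by
    apply Lp.ext
    filter_upwards [coeFn_lpMul (ContinuousMap.const _ c) ((fourierBasis d).repr.symm f),
      Lp.coeFn_smul (c : ℂ) ((fourierBasis d).repr.symm f)] with p h1 h2
    rw [h1, h2]
    rfl
  rw [multiplier_apply, h, map_smul, LinearIsometryEquiv.apply_symm_apply]

theorem multiplier_sub (g h : C(Torus d, ℝ)) (f : L2 d) :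
    multiplier (g - h) f = multiplier g f - multiplier h f := by
  simp only [multiplier_apply, ← map_sub]
  congr 1
  apply Lp.ext
  filter_upwards [coeFn_lpMul (g - h) ((fourierBasis d).repr.symm f),
    coeFn_lpMul g ((fourierBasis d).repr.symm f), coeFn_lpMul h ((fourierBasis d).repr.symm f),
    Lp.coeFn_sub (lpMul g ((fourierBasis d).repr.symm f))
      (lpMul h ((fourierBasis d).repr.symm f))] with p h1 h2 h3 h4
  rw [h1, h4, Pi.sub_apply, h2, h3, ContinuousMap.sub_apply, Complex.ofReal_sub, sub_mul]

theorem multiplier_isSymmetric (g : C(Torus d, ℝ)) : (multiplier g).IsSymmetric := by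
  intro f f'
  have h : ∀ (F G : Lp ℂ 2 (haar d)), inner ℂ (lpMul g F) G = inner ℂ F (lpMul g G) := by
    intro F G
    rw [L2.inner_def, L2.inner_def]
    refine integral_congr_ae ?_
    filter_upwards [coeFn_lpMul g F, coeFn_lpMul g G] with p h1 h2
    rw [h1, h2]
    simp only [RCLike.inner_apply, map_mul, Complex.conj_ofReal]
    ring
  rw [multiplier_apply, multiplier_apply, ← LinearIsometryEquiv.inner_map_map
    (fourierBasis d).repr.symm, ← LinearIsometryEquiv.inner_map_map
    (fourierBasis d).repr.symm f]
  simp only [LinearIsometryEquiv.symm_apply_apply]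
  exact h _ _

theorem re_inner_multiplier_nonneg {g : C(Torus d, ℝ)} (hg : ∀ p, 0 ≤ g p) (f : L2 d) :
    0 ≤ (inner ℂ f (multiplier g f)).re := by
  rw [multiplier_apply, ← LinearIsometryEquiv.inner_map_map (fourierBasis d).repr.symm]
  simp only [LinearIsometryEquiv.symm_apply_apply]
  set F := (fourierBasis d).repr.symm f
  have h : inner ℂ F (lpMul g F) = ((∫ p, g p * ‖F p‖ ^ 2 ∂haar d : ℝ) : ℂ) := by
    rw [L2.inner_def, ← integral_complex_ofReal]
    refine integral_congr_ae ?_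
    filter_upwards [coeFn_lpMul g F] with p h1
    rw [h1]
    simp only [RCLike.inner_apply]
    rw [mul_assoc, Complex.mul_conj, Complex.normSq_eq_norm_sq]
    push_cast
    rfl
  rw [h, Complex.ofReal_re]
  exact integral_nonneg fun p => mul_nonneg (hg p) (by positivity)

theorem symbolCoeff_neg {g : C(Torus d, ℝ)} (hg : ∀ p, g (-p) = g p) (x : Lattice d) :
    symbolCoeff g (-x) = symbolCoeff g x := by
  unfold symbolCoeff
  rw [← integral_neg_eq_self]
  refine integral_congr_ae (Filter.Eventually.of_forall fun p => ?_)
  simp only [hg, mFourier_neg_neg]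

theorem multiplier_mem_evenL2 {g : C(Torus d, ℝ)} (hg : ∀ p, g (-p) = g p) (f : L2 d)
    (hf : f ∈ evenL2 d) : multiplier g f ∈ evenL2 d := by
  intro x
  rw [← (hasSum_multiplier g f x).tsum_eq, ← (hasSum_multiplier g f (-x)).tsum_eq,
    ← (Equiv.neg (Lattice d)).tsum_eq]
  refine tsum_congr fun y => ?_
  change symbolCoeff g (-x - -y) * f (-y) = _
  rw [hf y, ← symbolCoeff_neg hg (x - y)]
  congr 2
  abel

/-- Multiplication by an even function in momentum space, on even functions. -/
noncomputable def evenMultiplier (g : C(Torus d, ℝ)) (hg : ∀ p, g (-p) = g p) : Module.End ℂ (evenL2 d) :=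
  (multiplier g).restrict (multiplier_mem_evenL2 hg)

theorem coe_evenMultiplier (g : C(Torus d, ℝ)) (hg : ∀ p, g (-p) = g p) (f : evenL2 d) :
    (evenMultiplier g hg f : L2 d) = multiplier g f := rfl

theorem evenMultiplier_isSymmetric (g : C(Torus d, ℝ)) (hg : ∀ p, g (-p) = g p) :
    (evenMultiplier g hg).IsSymmetric :=
  (multiplier_isSymmetric g).restrict_invariant _

theorem freeOperator_eq (ε : C(Torus d, ℝ)) (k : Torus d) :
    freeOperator ε k = evenMultiplier (pairDispersion ε k) (pairDispersion_neg ε k) := by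
  refine LinearMap.ext fun f => evenL2_ext fun x => ?_
  exact (hasSum_multiplier (pairDispersion ε k) (f : L2 d) x).tsum_eq

end Multipliers

/-! ### `L¹` continuity of inverses under a sublevel bound -/

section InverseIntegrals

variable {X : Type*} [MeasurableSpace X] {η : Measure X}

/-- The sublevel sets of `e` have measure `η {e ≤ r²} ≤ C r³` for `0 < r ≤ 1`. -/
def SublevelBound (η : Measure X) (e : X → ℝ) (C : ℝ) : Prop :=
  ∀ r : ℝ, 0 < r → r ≤ 1 → η {x | e x ≤ r ^ 2} ≤ ENNReal.ofReal (C * r ^ 3)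

/-- Dyadic shells: where `e` is comparable to `r² 4⁻ⁿ`, its inverse is at most `4ⁿ⁺¹ / r²`, while
the sublevel set has measure at most `C r³ 8⁻ⁿ`. The shells contribute `4 C r 2⁻ⁿ`, with sum `8 C
r`. Convergence rests on the exponent `3` exceeding `2`. -/
theorem SublevelBound.lintegral_inv_le {e : X → ℝ} {C : ℝ} (hC : 0 ≤ C)
    (h : SublevelBound η e C) (he0 : ∀ x, 0 ≤ e x) (hem : Measurable e) {r : ℝ} (hr : 0 < r)
    (hr1 : r ≤ 1) :
    ∫⁻ x, Set.indicator {x | e x ≤ r ^ 2} (fun x => ENNReal.ofReal (e x)⁻¹) x ∂η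
      ≤ ENNReal.ofReal (8 * C * r) := by
  have hq : ∀ n : ℕ, 0 < r * (1 / 2) ^ n ∧ r * (1 / 2) ^ n ≤ 1 := fun n =>
    ⟨by positivity, mul_le_one₀ hr1 (by positivity) (pow_le_one₀ (by norm_num) (by norm_num))⟩
  let S : ℕ → Set X := fun n => {x | e x ≤ (r * (1 / 2) ^ n) ^ 2}
  have hS : ∀ n, MeasurableSet (S n) := fun n => measurableSet_le hem measurable_const
  have hpt : ∀ x, Set.indicator {x | e x ≤ r ^ 2} (fun x => ENNReal.ofReal (e x)⁻¹) x
      ≤ ∑' n, Set.indicator (S n) (fun _ => ENNReal.ofReal (4 ^ (n + 1) / r ^ 2)) x := by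
    intro x
    by_cases hx : e x ≤ r ^ 2
    swap
    · rw [Set.indicator_of_notMem (by exact hx)]
      exact zero_le
    rw [Set.indicator_of_mem (by exact hx)]
    -- At a zero of `e` the inverse is `0` by convention, so the bound is trivial there.
    rcases (he0 x).eq_or_lt with h0 | h0
    · rw [← h0]
      simp
    obtain ⟨n, hn1, hn2⟩ := exists_nat_pow_near_of_lt_one (x := e x / r ^ 2) (y := 1 / 4)
      (by positivity) ((div_le_one (by positivity)).2 hx) (by norm_num) (by norm_num)
    have hmem : x ∈ S n := by
      change e x ≤ (r * (1 / 2) ^ n) ^ 2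
      rw [div_le_iff₀ (by positivity)] at hn2
      calc e x ≤ (1 / 4) ^ n * r ^ 2 := hn2
        _ = (r * (1 / 2) ^ n) ^ 2 := by
          rw [mul_pow, ← pow_mul, mul_comm n 2, pow_mul, mul_comm]
          norm_num
    refine le_trans ?_ (ENNReal.le_tsum n)
    rw [Set.indicator_of_mem hmem]
    refine ENNReal.ofReal_le_ofReal ?_
    rw [lt_div_iff₀ (by positivity)] at hn1
    rw [inv_le_comm₀ h0 (by positivity), inv_div]
    refine le_of_eq_of_le ?_ hn1.le
    rw [one_div, inv_pow, div_eq_inv_mul]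
  refine (lintegral_mono hpt).trans ?_
  rw [lintegral_tsum fun n => (measurable_const.indicator (hS n)).aemeasurable]
  have hterm : ∀ n, ∫⁻ x, Set.indicator (S n) (fun _ => ENNReal.ofReal (4 ^ (n + 1) / r ^ 2)) x ∂η
      ≤ ENNReal.ofReal (4 * C * r * (1 / 2) ^ n) := by
    intro n
    rw [lintegral_indicator_const (hS n)]
    refine (mul_le_mul_right (h _ (hq n).1 (hq n).2) _).trans ?_
    rw [← ENNReal.ofReal_mul (by positivity)]
    refine ENNReal.ofReal_le_ofReal (le_of_eq ?_)
    have h4 : (4 : ℝ) ^ n * (((1 / 2) ^ n) ^ 2) = 1 := by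
      rw [← pow_mul, mul_comm n 2, pow_mul, ← mul_pow]
      norm_num
    calc (4 : ℝ) ^ (n + 1) / r ^ 2 * (C * (r * (1 / 2) ^ n) ^ 3)
        = ((4 : ℝ) ^ n * (((1 / 2) ^ n) ^ 2)) * (4 * C * (1 / 2) ^ n) * (r ^ 3 / r ^ 2) := by ring
      _ = 4 * C * r * (1 / 2) ^ n := by
        rw [h4]
        field_simp
  refine (ENNReal.tsum_le_tsum hterm).trans ?_
  rw [← ENNReal.ofReal_tsum_of_nonneg (fun n => by positivity)
    ((summable_geometric_of_lt_one (by norm_num) (by norm_num)).mul_left _), tsum_mul_left,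
    tsum_geometric_of_lt_one (by norm_num) (by norm_num)]
  refine ENNReal.ofReal_le_ofReal (le_of_eq ?_)
  norm_num
  ring

theorem SublevelBound.integrable_inv [IsFiniteMeasure η] {e : X → ℝ} {C : ℝ} (hC : 0 ≤ C)
    (h : SublevelBound η e C) (he0 : ∀ x, 0 ≤ e x) (hem : Measurable e) :
    Integrable (fun x => (e x)⁻¹) η := by
  refine ⟨hem.inv.aestronglyMeasurable, ?_⟩
  rw [hasFiniteIntegral_iff_ofReal (Filter.Eventually.of_forall fun x => inv_nonneg.2 (he0 x))]
  have h1 := h.lintegral_inv_le hC he0 hem one_pos le_rfl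
  have hpt : ∀ x, ENNReal.ofReal (e x)⁻¹
      ≤ Set.indicator {x | e x ≤ 1 ^ 2} (fun x => ENNReal.ofReal (e x)⁻¹) x + 1 := by
    intro x
    by_cases hx : e x ≤ 1 ^ 2
    · rw [Set.indicator_of_mem (by exact hx)]
      exact le_self_add
    · rw [Set.indicator_of_notMem (by exact hx), zero_add, ← ENNReal.ofReal_one]
      refine ENNReal.ofReal_le_ofReal (inv_le_one_of_one_le₀ ?_)
      rw [one_pow] at hx
      exact (not_le.1 hx).le
  refine (lintegral_mono hpt).trans_lt ?_
  rw [lintegral_add_right _ measurable_const]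
  refine ENNReal.add_lt_top.2 ⟨h1.trans_lt ENNReal.ofReal_lt_top, ?_⟩
  simp

/-- Where both functions exceed `r²`, the inverses differ by at most `δ / r⁴`. Elsewhere one of them
is at most `r²`, and then both are at most `r² + δ ≤ (2r)²`; there the difference is bounded by the
sum of the inverses, and each integral is at most `8 C (2r)`. -/
theorem SublevelBound.integral_abs_inv_sub_inv_le [IsProbabilityMeasure η] {e₁ e₂ : X → ℝ} {C : ℝ}
    (hC : 0 ≤ C) (h₁ : SublevelBound η e₁ C) (h₂ : SublevelBound η e₂ C)
    (he₁ : ∀ x, 0 ≤ e₁ x) (he₂ : ∀ x, 0 ≤ e₂ x) (hm₁ : Measurable e₁) (hm₂ : Measurable e₂)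
    {r δ : ℝ} (hr : 0 < r) (hr1 : 2 * r ≤ 1) (hδ : δ ≤ r ^ 2)
    (hd : ∀ x, |e₁ x - e₂ x| ≤ δ) :
    ∫ x, |(e₁ x)⁻¹ - (e₂ x)⁻¹| ∂η ≤ 32 * C * r + δ / r ^ 4 := by
  have hX : Nonempty X := nonempty_of_isProbabilityMeasure η
  have hδ0 : 0 ≤ δ := (abs_nonneg _).trans (hd hX.some)
  have hpt : ∀ x, ENNReal.ofReal |(e₁ x)⁻¹ - (e₂ x)⁻¹|
      ≤ Set.indicator {x | e₁ x ≤ (2 * r) ^ 2} (fun x => ENNReal.ofReal (e₁ x)⁻¹) x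
        + Set.indicator {x | e₂ x ≤ (2 * r) ^ 2} (fun x => ENNReal.ofReal (e₂ x)⁻¹) x
        + ENNReal.ofReal (δ / r ^ 4) := by
    intro x
    have hdx := abs_le.1 (hd x)
    by_cases hx : r ^ 2 < e₁ x ∧ r ^ 2 < e₂ x
    · refine le_trans (ENNReal.ofReal_le_ofReal ?_) le_add_self
      have h1 : 0 < e₁ x := (by positivity : 0 < r ^ 2).trans hx.1
      have h2 : 0 < e₂ x := (by positivity : 0 < r ^ 2).trans hx.2
      rw [inv_sub_inv h1.ne' h2.ne', abs_div, abs_of_pos (mul_pos h1 h2), abs_sub_comm]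
      refine div_le_div₀ hδ0 (hd x) (by positivity) ?_
      calc r ^ 4 = r ^ 2 * r ^ 2 := by ring
        _ ≤ e₁ x * e₂ x := mul_le_mul hx.1.le hx.2.le (by positivity) h1.le
    · have h12 : e₁ x ≤ (2 * r) ^ 2 ∧ e₂ x ≤ (2 * r) ^ 2 := by
        rw [not_and_or, not_lt, not_lt] at hx
        have : 0 < r ^ 2 := by positivity
        constructor <;> rcases hx with hx | hx <;> nlinarith
      rw [Set.indicator_of_mem (by exact h12.1), Set.indicator_of_mem (by exact h12.2),
        ← ENNReal.ofReal_add (inv_nonneg.2 (he₁ x)) (inv_nonneg.2 (he₂ x))]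
      refine le_trans (ENNReal.ofReal_le_ofReal ?_) le_self_add
      have h1 := inv_nonneg.2 (he₁ x)
      have h2 := inv_nonneg.2 (he₂ x)
      rw [abs_le]
      constructor <;> linarith
  rw [integral_eq_lintegral_of_nonneg_ae (Filter.Eventually.of_forall fun x => abs_nonneg _)
    (show Measurable fun x => |(e₁ x)⁻¹ - (e₂ x)⁻¹| by fun_prop).aestronglyMeasurable]
  refine ENNReal.toReal_le_of_le_ofReal (by positivity) ((lintegral_mono hpt).trans ?_)
  have hs1 : MeasurableSet {x | e₁ x ≤ (2 * r) ^ 2} := measurableSet_le hm₁ measurable_const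
  rw [lintegral_add_right _ measurable_const, lintegral_add_left
    ((show Measurable fun x => ENNReal.ofReal (e₁ x)⁻¹ by fun_prop).indicator hs1), lintegral_const, measure_univ, mul_one]
  refine (add_le_add (add_le_add (h₁.lintegral_inv_le hC he₁ hm₁ (by positivity) hr1)
    (h₂.lintegral_inv_le hC he₂ hm₂ (by positivity) hr1)) le_rfl).trans ?_
  rw [← ENNReal.ofReal_add (by positivity) (by positivity),
    ← ENNReal.ofReal_add (by positivity) (by positivity)]
  refine ENNReal.ofReal_le_ofReal (le_of_eq ?_)
  ring

/-- `1 / e₁` and `1 / e₂` are close in `L¹` when `e₁` and `e₂` are uniformly close and obey a common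
bound on the measures of their sublevel sets. -/
theorem SublevelBound.exists_integral_abs_inv_sub_inv_le {C : ℝ} (hC : 0 ≤ C) {ρ : ℝ}
    (hρ : 0 < ρ) : ∃ δ : ℝ, 0 < δ ∧ ∀ (η : Measure X) [IsProbabilityMeasure η] (e₁ e₂ : X → ℝ),
      SublevelBound η e₁ C → SublevelBound η e₂ C → (∀ x, 0 ≤ e₁ x) → (∀ x, 0 ≤ e₂ x) →
      Measurable e₁ → Measurable e₂ → (∀ x, |e₁ x - e₂ x| ≤ δ) →
      ∫ x, |(e₁ x)⁻¹ - (e₂ x)⁻¹| ∂η ≤ ρ := by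
  -- This radius makes `32 C r ≤ ρ / 2` with `2 r ≤ 1`; `δ` is then chosen so that `δ ≤ r²` and `δ /
  -- r⁴ ≤ ρ / 2`.
  set r : ℝ := min (1 / 2) (ρ / (64 * (C + 1))) with hr
  have hr0 : 0 < r := lt_min (by norm_num) (by positivity)
  have hr1 : r ≤ 1 / 2 := min_le_left _ _
  have hr2 : 32 * C * r ≤ ρ / 2 := by
    have h := min_le_right (1 / 2) (ρ / (64 * (C + 1)))
    rw [← hr, le_div_iff₀ (by positivity)] at h
    nlinarith
  refine ⟨min (r ^ 2) (ρ / 2 * r ^ 4), lt_min (by positivity) (by positivity), ?_⟩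
  intro η _ e₁ e₂ h₁ h₂ he₁ he₂ hm₁ hm₂ hd
  refine (h₁.integral_abs_inv_sub_inv_le hC h₂ he₁ he₂ hm₁ hm₂ hr0 (by linarith)
    (min_le_left _ _) hd).trans ?_
  have h : min (r ^ 2) (ρ / 2 * r ^ 4) / r ^ 4 ≤ ρ / 2 := by
    rw [div_le_iff₀ (by positivity)]
    exact min_le_right _ _
  linarith

end InverseIntegrals

/-! ### Second-order conditions at a minimum -/

section QuadraticGrowth

variable {E : Type*} [NormedAddCommGroup E] [NormedSpace ℝ E]

/-- Along the segment, `f` minus `a r² / 2` has nonnegative second derivative in `r`, so it is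
convex; compare its value at `0` with those at `±1`. -/
theorem le_second_difference {f : E → ℝ} {f' : E → E →L[ℝ] ℝ} {f'' : E → E →L[ℝ] E →L[ℝ] ℝ}
    (hf : ∀ x, HasFDerivAt f (f' x) x) (hf' : ∀ x, HasFDerivAt f' (f'' x) x) (m u : E) {a : ℝ}
    (ha : ∀ r : ℝ, |r| ≤ 1 → a ≤ f'' (m + r • u) u u) :
    a ≤ f (m + u) + f (m - u) - 2 * f m := by
  have hline : ∀ r : ℝ, HasDerivAt (fun r : ℝ => m + r • u) u r := fun r => by
    simpa using ((hasDerivAt_id r).smul_const u).const_add m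
  have h1 : ∀ r : ℝ, HasDerivAt (fun r : ℝ => f (m + r • u) - a / 2 * r ^ 2)
      (f' (m + r • u) u - a * r) r := fun r => by
    refine ((hf _).comp_hasDerivAt r (hline r)).sub ?_
    have h := (hasDerivAt_pow 2 r).const_mul (a / 2)
    refine h.congr_deriv ?_
    simp
    ring
  have h2 : ∀ r : ℝ, HasDerivAt (fun r : ℝ => f' (m + r • u) u - a * r)
      (f'' (m + r • u) u u - a) r := fun r => by
    have h3 : HasDerivAt (fun r : ℝ => f' (m + r • u)) (f'' (m + r • u) u) r :=
      (hf' _).comp_hasDerivAt r (hline r)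
    have h4 : HasDerivAt (fun r : ℝ => f' (m + r • u) u) (f'' (m + r • u) u u) r := by
      simpa using h3.clm_apply (hasDerivAt_const r u)
    refine h4.sub ?_
    simpa using (hasDerivAt_id r).const_mul a
  have hconv : ConvexOn ℝ (Set.Icc (-1 : ℝ) 1) fun r : ℝ => f (m + r • u) - a / 2 * r ^ 2 := by
    refine convexOn_of_hasDerivWithinAt2_nonneg (convex_Icc _ _)
      (fun r _ => (h1 r).continuousAt.continuousWithinAt)
      (fun r _ => (h1 r).hasDerivWithinAt) (fun r _ => (h2 r).hasDerivWithinAt) fun r hr => ?_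
    rw [interior_Icc] at hr
    exact sub_nonneg.2 (ha r (abs_le.2 ⟨hr.1.le, hr.2.le⟩))
  have h := hconv.2 (show (1 : ℝ) ∈ Set.Icc (-1 : ℝ) 1 by simp)
    (show (-1 : ℝ) ∈ Set.Icc (-1 : ℝ) 1 by simp) (show (0 : ℝ) ≤ 1 / 2 by norm_num)
    (show (0 : ℝ) ≤ 1 / 2 by norm_num) (by norm_num)
  norm_num at h
  rw [← sub_eq_add_neg] at h
  linarith

/-- The second derivative at a minimum is positive semidefinite. -/
theorem second_derivative_nonneg_of_min {f : E → ℝ} {f' : E → E →L[ℝ] ℝ}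
    {f'' : E → E →L[ℝ] E →L[ℝ] ℝ} (hf : ∀ x, HasFDerivAt f (f' x) x)
    (hf' : ∀ x, HasFDerivAt f' (f'' x) x) (hc : Continuous f'') {t : E} (ht : ∀ x, f t ≤ f x)
    (u : E) : 0 ≤ f'' t u u := by
  by_contra! hneg
  have hcont : Continuous fun r : ℝ => f'' (t + r • u) u u := by fun_prop
  have hev : ∀ᶠ r in nhds (0 : ℝ), f'' (t + r • u) u u < f'' t u u / 2 := by
    refine hcont.continuousAt.eventually_lt continuousAt_const ?_
    simp only [zero_smul, add_zero]
    linarith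
  obtain ⟨ρ, hρ, hball⟩ := Metric.eventually_nhds_iff.1 hev
  have hρ2 : 0 < ρ / 2 := by positivity
  -- If `f''` is negative along `u`, then `-f` has a positive second difference on a short segment
  -- through `t`, contradicting minimality.
  have h := le_second_difference (f := fun x => -f x) (f' := fun x => -f' x)
    (f'' := fun x => -f'' x) (fun x => (hf x).neg) (fun x => (hf' x).neg) t ((ρ / 2) • u)
    (a := (ρ / 2) ^ 2 * (-(f'' t u u / 2))) (fun r hr => by
      have h1 : dist (r * (ρ / 2)) 0 < ρ := by
        rw [dist_zero_right, norm_mul, Real.norm_eq_abs, Real.norm_of_nonneg hρ2.le]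
        nlinarith [abs_nonneg r]
      have h2 := hball h1
      simp only [neg_apply, map_smul, smul_apply,
        smul_eq_mul, smul_smul]
      nlinarith [sq_nonneg (ρ / 2)])
  have h1 := ht (t + (ρ / 2) • u)
  have h2 := ht (t - (ρ / 2) • u)
  have h3 : 0 < (ρ / 2) ^ 2 * (-(f'' t u u / 2)) := mul_pos (by positivity) (by linarith)
  linarith

/-- A nondegenerate minimum has a positive definite Hessian. -/
theorem exists_le_second_derivative_of_min [FiniteDimensional ℝ E] {f : E → ℝ}
    {f' : E → E →L[ℝ] ℝ} {f'' : E → E →L[ℝ] E →L[ℝ] ℝ} (hf : ∀ x, HasFDerivAt f (f' x) x)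
    (hf' : ∀ x, HasFDerivAt f' (f'' x) x) (hc : Continuous f'') {t : E} (ht : ∀ x, f t ≤ f x)
    (hnd : ∀ u, (∀ w, f'' t u w = 0) → u = 0) :
    ∃ c : ℝ, 0 < c ∧ ∀ u, c * ‖u‖ ^ 2 ≤ f'' t u u := by
  have hpsd := second_derivative_nonneg_of_min hf hf' hc ht
  have hsymm : ∀ u w, f'' t u w = f'' t w u := second_derivative_symmetric hf (hf' t)
  have hpos : ∀ u, u ≠ 0 → 0 < f'' t u u := by
    intro u hu
    refine (hpsd u).lt_of_ne fun h0 => hu (hnd u fun w => ?_)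
    -- A null vector of a positive semidefinite form lies in its radical: this affine function of
    -- `r` is bounded below only if its slope vanishes. The value of `r` used next would make it
    -- `-1`.
    have hq : ∀ r : ℝ, 0 ≤ f'' t w w + 2 * r * f'' t u w := by
      intro r
      have h := hpsd (w + r • u)
      simp only [map_add, map_smul, add_apply, smul_apply,
        smul_eq_mul, hsymm w u, ← h0] at h
      linarith
    by_contra hne
    have h := hq (-(f'' t w w + 1) / (2 * f'' t u w))
    have h2 : 2 * (-(f'' t w w + 1) / (2 * f'' t u w)) * f'' t u w = -(f'' t w w + 1) := by
      field_simp
    linarith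
  obtain ⟨c, hc0, hcs⟩ := (isCompact_sphere (0 : E) 1).exists_forall_le' (a := (0 : ℝ))
    (f := fun u => f'' t u u) (by fun_prop) (fun u hu => hpos u (by
      rintro rfl
      simp at hu))
  refine ⟨c, hc0, fun u => ?_⟩
  rcases eq_or_ne u 0 with rfl | hu
  · simp
  · have hn : 0 < ‖u‖ := norm_pos_iff.2 hu
    have h := hcs (‖u‖⁻¹ • u) (by simp [norm_smul, hn.ne'])
    simp only [map_smul, smul_apply, smul_eq_mul] at h
    have h2 := mul_le_mul_of_nonneg_right h (sq_nonneg ‖u‖)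
    refine h2.trans_eq ?_
    field_simp

end QuadraticGrowth

/-! ### Uniform strong convexity near a nondegenerate minimum -/

section StrongConvexity

variable {E : Type*} [NormedAddCommGroup E] [NormedSpace ℝ E] [FiniteDimensional ℝ E]

/-- Near a nondegenerate minimum `t₀` of `t ↦ f (s₀ + t) + f (s₀ - t)`, the functions
`t ↦ f (s + t) + f (s - t)` are uniformly strongly convex. -/
theorem exists_strongly_convex_near_min {f : E → ℝ} (hε : ContDiff ℝ 2 f) (s₀ t₀ : E)
    (hmin : ∀ t, f (s₀ + t₀) + f (s₀ - t₀) ≤ f (s₀ + t) + f (s₀ - t))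
    (hM : fderiv ℝ (fun t => f (s₀ + t) + f (s₀ - t)) t₀ = 0 → ∀ u,
      (∀ w, fderiv ℝ (fderiv ℝ fun t => f (s₀ + t) + f (s₀ - t)) t₀ u w = 0) → u = 0) :
    ∃ ρ c : ℝ, 0 < ρ ∧ 0 < c ∧ ∀ᶠ s in nhds s₀, ∀ x ∈ Metric.ball t₀ ρ, ∀ y ∈ Metric.ball t₀ ρ,
      c * dist x y ^ 2 ≤ (f (s + x) + f (s - x)) + (f (s + y) + f (s - y))
        - 2 * (f (s + (1 / 2 : ℝ) • (x + y)) + f (s - (1 / 2 : ℝ) • (x + y))) := by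
  set f₁ := fderiv ℝ f with hf₁
  set f₂ := fderiv ℝ f₁ with hf₂
  have hd1 : ∀ x, HasFDerivAt f (f₁ x) x := fun x =>
    (hε.differentiable (by norm_num) x).hasFDerivAt
  have hC1 : ContDiff ℝ 1 f₁ := hε.fderiv_right (by norm_num)
  have hd2 : ∀ x, HasFDerivAt f₁ (f₂ x) x := fun x =>
    (hC1.differentiable (by norm_num) x).hasFDerivAt
  have hc2 : Continuous f₂ := hC1.continuous_fderiv (by norm_num)
  let g : E → E → ℝ := fun s t => f (s + t) + f (s - t)
  have hadd : ∀ s t : E, HasFDerivAt (fun t => s + t)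
      (ContinuousLinearMap.id ℝ E) t := fun s t => (hasFDerivAt_id t).const_add s
  have hsub : ∀ s t : E, HasFDerivAt (fun t => s - t)
      (-ContinuousLinearMap.id ℝ E) t := fun s t => (hasFDerivAt_id t).const_sub s
  have hg1 : ∀ s t, HasFDerivAt (g s) (f₁ (s + t) - f₁ (s - t)) t := fun s t => by
    refine (((hd1 (s + t)).comp t (hadd s t)).add ((hd1 (s - t)).comp t (hsub s t))).congr_fderiv
      ?_
    ext u
    simp [sub_eq_add_neg]
  have hg2 : ∀ s t, HasFDerivAt (fun t => f₁ (s + t) - f₁ (s - t)) (f₂ (s + t) + f₂ (s - t)) t :=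
    fun s t => by
    refine (((hd2 (s + t)).comp t (hadd s t)).sub ((hd2 (s - t)).comp t (hsub s t))).congr_fderiv
      ?_
    ext u w
    simp
  have hF1 : fderiv ℝ (g s₀) = fun t => f₁ (s₀ + t) - f₁ (s₀ - t) :=
    funext fun t => (hg1 s₀ t).fderiv
  have hF2 : fderiv ℝ (fderiv ℝ (g s₀)) = fun t => f₂ (s₀ + t) + f₂ (s₀ - t) := by
    rw [hF1]
    exact funext fun t => (hg2 s₀ t).fderiv
  have hcrit : fderiv ℝ (g s₀) t₀ = 0 :=
    IsLocalMin.fderiv_eq_zero (Filter.Eventually.of_forall hmin)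
  have hnd : ∀ u, (∀ w, (f₂ (s₀ + t₀) + f₂ (s₀ - t₀)) u w = 0) → u = 0 := by
    intro u hu
    refine hM hcrit u fun w => ?_
    rw [hF2]
    exact hu w
  obtain ⟨c, hc0, hc⟩ := exists_le_second_derivative_of_min (hg1 s₀) (hg2 s₀)
    ((hc2.comp (continuous_const.add continuous_id)).add
      (hc2.comp (continuous_const.sub continuous_id))) hmin
    hnd
  have hH : Continuous fun x : E × E => f₂ (x.1 + x.2) + f₂ (x.1 - x.2) :=
    (hc2.comp (continuous_fst.add continuous_snd)).add
      (hc2.comp (continuous_fst.sub continuous_snd))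
  -- The Hessian is jointly continuous in `(s, t)`, so a perturbation by `c / 2` in norm leaves half
  -- of the lower bound.
  have hev : ∀ᶠ x : E × E in nhds (s₀, t₀),
      ‖(f₂ (x.1 + x.2) + f₂ (x.1 - x.2)) - (f₂ (s₀ + t₀) + f₂ (s₀ - t₀))‖ < c / 2 := by
    have h1 := (Metric.tendsto_nhds (α := E →L[ℝ] E →L[ℝ] ℝ)).1 (hH.tendsto (s₀, t₀)) (c / 2) (by positivity)
    filter_upwards [h1] with x hx
    exact lt_of_eq_of_lt (dist_eq_norm (E := E →L[ℝ] E →L[ℝ] ℝ) _ _).symm hx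
  have hlow : ∀ x : E × E,
      ‖(f₂ (x.1 + x.2) + f₂ (x.1 - x.2)) - (f₂ (s₀ + t₀) + f₂ (s₀ - t₀))‖ < c / 2 →
      ∀ u, c / 2 * ‖u‖ ^ 2 ≤ (f₂ (x.1 + x.2) + f₂ (x.1 - x.2)) u u := by
    intro x hx u
    set D := (f₂ (x.1 + x.2) + f₂ (x.1 - x.2)) - (f₂ (s₀ + t₀) + f₂ (s₀ - t₀)) with hD
    have h1 : |D u u| ≤ c / 2 * ‖u‖ ^ 2 := by
      refine (D.le_opNorm₂ u u).trans ?_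
      rw [mul_assoc, ← sq]
      exact mul_le_mul_of_nonneg_right hx.le (sq_nonneg _)
    have h2 : (f₂ (x.1 + x.2) + f₂ (x.1 - x.2)) u u
        = (f₂ (s₀ + t₀) + f₂ (s₀ - t₀)) u u + D u u := by
      rw [hD]
      simp
    rw [h2]
    have h3 := hc u
    have h4 := (abs_le.1 h1).1
    linarith
  rw [nhds_prod_eq] at hev
  obtain ⟨pa, hpa, pb, hpb, hab⟩ := Filter.eventually_prod_iff.1 hev
  obtain ⟨ρ, hρ, hball⟩ := Metric.eventually_nhds_iff_ball.1 hpb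
  -- The second difference is at least `c / 2 * ‖u‖²` and `dist x y = 2 * ‖u‖`, whence `c / 8`.
  refine ⟨ρ, c / 8, hρ, by positivity, ?_⟩
  filter_upwards [hpa] with s hs x hxb y hyb
  set m : E := (1 / 2 : ℝ) • (x + y) with hm
  set u : E := (1 / 2 : ℝ) • (x - y) with hu
  have hmx : m + u = x := by
    rw [hm, hu, ← smul_add, add_add_sub_cancel, ← two_smul ℝ x, smul_smul]
    norm_num
  have hmy : m - u = y := by
    rw [hm, hu, ← smul_sub, add_sub_sub_cancel, ← two_smul ℝ y, smul_smul]
    norm_num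
  have hkey := le_second_difference (hg1 s) (hg2 s) m u (a := c / 2 * ‖u‖ ^ 2) (by
    intro r hr
    refine hlow (s, m + r • u) (hab hs (hball _ ?_)) u
    rw [abs_le] at hr
    have h1 : m + r • u = ((1 + r) / 2) • x + ((1 - r) / 2) • y := by
      rw [hm, hu]
      module
    rw [h1]
    exact (convex_ball t₀ ρ) hxb hyb (by linarith) (by linarith) (by ring))
  rw [hmx, hmy] at hkey
  have hu2 : dist x y = 2 * ‖u‖ := by
    rw [dist_eq_norm, hu, norm_smul]
    norm_num
    ring
  rw [hu2]
  refine le_trans (le_of_eq ?_) hkey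
  ring

end StrongConvexity

/-! ### Sublevel sets of the pair gap -/

section PairGap

variable {d : ℕ}

theorem continuous_toTorus : Continuous (toTorus : (Fin d → ℝ) → Torus d) :=
  continuous_pi fun i => (AddCircle.continuous_mk' 1).comp (continuous_apply i)

theorem isOpenMap_toTorus : IsOpenMap (toTorus : (Fin d → ℝ) → Torus d) := by
  have h := IsOpenMap.piMap (f := fun (_ : Fin d) (t : ℝ) => (t : UnitAddCircle))
    (fun _ => QuotientAddGroup.isOpenMap_coe) (by
      rw [Filter.cofinite_eq_bot]
      exact Filter.eventually_bot)
  exact h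

theorem toTorus_add (s t : Fin d → ℝ) : toTorus (s + t) = toTorus s + toTorus t := rfl

theorem measurePreserving_toTorus :
    MeasurePreserving (toTorus : (Fin d → ℝ) → Torus d)
      (volume.restrict (Set.univ.pi fun _ => Set.Ioc (0 : ℝ) 1)) (haar d) := by
  have h1 : (AddCircle.haarAddCircle : Measure UnitAddCircle) = volume := by
    rw [AddCircle.volume_eq_smul_haarAddCircle]
    simp
  have h2 := measurePreserving_pi (fun _ : Fin d => volume.restrict (Set.Ioc (0 : ℝ) (0 + 1)))
    (fun _ : Fin d => (volume : Measure UnitAddCircle))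
    (fun _ => UnitAddCircle.measurePreserving_mk 0)
  rw [← Measure.restrict_pi_pi, zero_add] at h2
  unfold haar
  rw [h1]
  exact h2

theorem exists_toTorus_eq (h : Torus d) : ∃ s, toTorus s = h := by
  choose s hs using fun i => QuotientAddGroup.mk_surjective (h i)
  exact ⟨s, funext hs⟩

/-- `p ↦ ε (h + p) + ε (h - p)`, the pair dispersion relation at quasi-momentum `2h`. -/
noncomputable def pairSum (ε : C(Torus d, ℝ)) (h : Torus d) : C(Torus d, ℝ) where
  toFun p := ε (h + p) + ε (h - p)

theorem pairSum_apply (ε : C(Torus d, ℝ)) (h p : Torus d) :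
    pairSum ε h p = ε (h + p) + ε (h - p) := rfl

theorem continuous_pairSum (ε : C(Torus d, ℝ)) : Continuous (pairSum ε) := by
  refine ContinuousMap.continuous_of_continuous_uncurry _ ?_
  change Continuous fun x : Torus d × Torus d => ε (x.1 + x.2) + ε (x.1 - x.2)
  fun_prop

theorem bddBelow_range_of_compact (g : C(Torus d, ℝ)) : BddBelow (Set.range g) :=
  (isCompact_range g.continuous).bddBelow

/-- The pair dispersion relation, measured from its minimum. -/
noncomputable def pairGap (ε : C(Torus d, ℝ)) (h : Torus d) : C(Torus d, ℝ) :=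
  pairSum ε h - ContinuousMap.const _ (⨅ q, pairSum ε h q)

theorem pairGap_apply (ε : C(Torus d, ℝ)) (h p : Torus d) :
    pairGap ε h p = pairSum ε h p - ⨅ q, pairSum ε h q := rfl

theorem pairGap_nonneg (ε : C(Torus d, ℝ)) (h p : Torus d) : 0 ≤ pairGap ε h p :=
  sub_nonneg.2 (ciInf_le (bddBelow_range_of_compact _) p)

theorem continuous_pairGap (ε : C(Torus d, ℝ)) : Continuous (pairGap ε) := by
  have h1 : Continuous fun h : Torus d => ⨅ q, pairSum ε h q := by
    have h2 := (isCompact_univ (X := Torus d)).continuous_sInf (f := fun h q => pairSum ε h q)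
      (by
        change Continuous fun x : Torus d × Torus d => ε (x.1 + x.2) + ε (x.1 - x.2)
        fun_prop)
    simpa only [Set.image_univ, sInf_range] using h2
  exact (continuous_pairSum ε).sub ((ContinuousMap.continuous_const').comp h1)

/-- Such a set lies in a closed ball of radius `R`, which for the sup metric is a cube of side `2
R`. Bounding diameters avoids locating the minimizers of the perturbed functions. -/
theorem volume_le_of_dist_le {A : Set (Fin d → ℝ)} {R : ℝ} (hR : 0 ≤ R)
    (h : ∀ x ∈ A, ∀ y ∈ A, dist x y ≤ R) : volume A ≤ ENNReal.ofReal ((2 * R) ^ d) := by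
  rcases A.eq_empty_or_nonempty with rfl | ⟨x, hx⟩
  · simp
  · refine (measure_mono (t := Metric.closedBall x R) fun y hy => h y hy x hx).trans ?_
    rw [Real.volume_pi_closedBall x hR, Fintype.card_fin]

/-- Near a nondegenerate minimum or a point which is not a minimum, the sublevel sets of the pair
gap are uniformly small. -/
theorem exists_volume_sublevel_le (hd : 3 ≤ d) (ε : C(Torus d, ℝ))
    (hε : ContDiff ℝ 2 (ε ∘ toTorus)) (s₀ t₀ : Fin d → ℝ)
    (hM : IsMorse (pairSum ε (toTorus s₀))) :
    ∃ S ∈ nhds t₀, ∃ C : ℝ, 0 ≤ C ∧ ∀ᶠ s in nhds s₀, ∀ r : ℝ, 0 < r → r ≤ 1 →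
      volume {t | t ∈ S ∧ pairGap ε (toTorus s) (toTorus t) ≤ r ^ 2}
        ≤ ENNReal.ofReal (C * r ^ 3) := by
  have hcont : Continuous fun x : (Fin d → ℝ) × (Fin d → ℝ) =>
      pairGap ε (toTorus x.1) (toTorus x.2) :=
    (ContinuousEval.continuous_eval (F := C(Torus d, ℝ))).comp
      (((continuous_pairGap ε).comp (continuous_toTorus.comp continuous_fst)).prodMk
        (continuous_toTorus.comp continuous_snd))
  rcases (pairGap_nonneg ε (toTorus s₀) (toTorus t₀)).eq_or_lt with h0 | h0
  · have hmin : ∀ t, ε (toTorus (s₀ + t₀)) + ε (toTorus (s₀ - t₀))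
        ≤ ε (toTorus (s₀ + t)) + ε (toTorus (s₀ - t)) := by
      intro t
      have h1 := ciInf_le (bddBelow_range_of_compact (pairSum ε (toTorus s₀))) (toTorus t)
      have h2 : pairSum ε (toTorus s₀) (toTorus t₀) = ⨅ q, pairSum ε (toTorus s₀) q :=
        (sub_eq_zero.1 h0.symm)
      exact h2.trans_le h1
    obtain ⟨ρ, c, hρ, hc0, hpa⟩ := exists_strongly_convex_near_min hε s₀ t₀ hmin
      (fun hcrit => hM.2 t₀ hcrit)
    refine ⟨Metric.ball t₀ ρ, Metric.ball_mem_nhds _ hρ, (2 * (2 / √c)) ^ d, by positivity, ?_⟩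
    filter_upwards [hpa] with s hs r hr hr1
    refine (volume_le_of_dist_le (R := 2 * r / √c) (by positivity) ?_).trans ?_
    · rintro x ⟨hxb, hx⟩ y ⟨hyb, hy⟩
      have hkey := hs x hxb y hyb
      -- The gap is nonnegative at the midpoint and at most `r²` at `x` and `y`, so strong convexity
      -- gives `c * dist x y ^ 2 ≤ 2 * r ^ 2`.
      set m : Fin d → ℝ := (1 / 2 : ℝ) • (x + y) with hm
      have hmg := pairGap_nonneg ε (toTorus s) (toTorus m)
      rw [pairGap_apply] at hx hy hmg
      have hx' : ε (toTorus (s + x)) + ε (toTorus (s - x)) - (⨅ q, pairSum ε (toTorus s) q)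
          ≤ r ^ 2 := hx
      have hy' : ε (toTorus (s + y)) + ε (toTorus (s - y)) - (⨅ q, pairSum ε (toTorus s) q)
          ≤ r ^ 2 := hy
      have hm' : 0 ≤ ε (toTorus (s + m)) + ε (toTorus (s - m)) - (⨅ q, pairSum ε (toTorus s) q) :=
        hmg
      simp only [Function.comp_apply] at hkey
      have h3 : c * dist x y ^ 2 ≤ (2 * r) ^ 2 := by nlinarith
      have h4 : √c * dist x y ≤ 2 * r := by
        refine le_of_sq_le_sq ?_ (by positivity)
        rw [mul_pow, Real.sq_sqrt hc0.le]
        exact h3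
      rw [le_div_iff₀ (Real.sqrt_pos.2 hc0)]
      linarith
    · refine ENNReal.ofReal_le_ofReal ?_
      have h1 : 2 * (2 * r / √c) = (2 * (2 / √c)) * r := by ring
      rw [h1, mul_pow]
      exact mul_le_mul_of_nonneg_left (pow_le_pow_of_le_one hr.le hr1 hd) (by positivity)
  · set κ := pairGap ε (toTorus s₀) (toTorus t₀) with hκ
    have hev : ∀ᶠ x : (Fin d → ℝ) × (Fin d → ℝ) in nhds (s₀, t₀),
        κ / 2 < pairGap ε (toTorus x.1) (toTorus x.2) :=
      continuousAt_const.eventually_lt hcont.continuousAt (by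
        change κ / 2 < κ
        linarith)
    rw [nhds_prod_eq] at hev
    obtain ⟨pa, hpa, pb, hpb, hab⟩ := Filter.eventually_prod_iff.1 hev
    have hq : 0 < √(κ / 2) := Real.sqrt_pos.2 (by linarith)
    refine ⟨{t | pb t} ∩ Metric.closedBall t₀ 1,
      Filter.inter_mem hpb (Metric.closedBall_mem_nhds _ one_pos), 2 ^ d / √(κ / 2) ^ 3,
      by positivity, ?_⟩
    filter_upwards [hpa] with s hs r hr hr1
    -- Away from the minima the gap exceeds `κ / 2`: for small `r` the sublevel set is empty, and
    -- for larger `r` the volume `2 ^ d` of the unit ball is absorbed into the constant.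
    by_cases hrq : r ≤ √(κ / 2)
    · have : {t | t ∈ {t | pb t} ∩ Metric.closedBall t₀ 1 ∧
          pairGap ε (toTorus s) (toTorus t) ≤ r ^ 2} = ∅ := by
        ext t
        simp only [Set.mem_ofPred_eq, Set.mem_empty_iff_false, iff_false]
        rintro ⟨⟨h1, -⟩, h2⟩
        have h3 := hab hs h1
        have h4 : r ^ 2 ≤ κ / 2 := by
          rw [← Real.sq_sqrt (by linarith : 0 ≤ κ / 2)]
          exact pow_le_pow_left₀ hr.le hrq 2
        simp only at h3
        linarith
      rw [this]
      simp
    · refine (measure_mono (t := Metric.closedBall t₀ 1) fun t ht => ht.1.2).trans ?_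
      rw [Real.volume_pi_closedBall t₀ zero_le_one, Fintype.card_fin, mul_one]
      refine ENNReal.ofReal_le_ofReal ?_
      rw [div_mul_eq_mul_div, le_div_iff₀ (by positivity)]
      exact mul_le_mul_of_nonneg_left
        (pow_le_pow_left₀ hq.le (not_le.1 hrq).le 3) (by positivity)

/-- The uniform bound on the sublevel sets of the pair gap near a quasi-momentum at which the pair
dispersion relation is a Morse function. -/
theorem exists_sublevelBound_pairGap (hd : 3 ≤ d) (ε : C(Torus d, ℝ))
    (hε : ContDiff ℝ 2 (ε ∘ toTorus)) (h₀ : Torus d) (hM : IsMorse (pairSum ε h₀)) :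
    ∃ C : ℝ, 0 ≤ C ∧ ∀ᶠ h in nhds h₀, SublevelBound (haar d) (pairGap ε h) C := by
  obtain ⟨s₀, rfl⟩ := exists_toTorus_eq h₀
  have hK : IsCompact (Set.univ.pi fun _ : Fin d => Set.Icc (0 : ℝ) 1) :=
    isCompact_univ_pi fun _ => isCompact_Icc
  have hmain : ∃ C : ℝ, 0 ≤ C ∧ ∀ᶠ s in nhds s₀, ∀ r : ℝ, 0 < r → r ≤ 1 →
      volume {t | t ∈ (Set.univ.pi fun _ : Fin d => Set.Icc (0 : ℝ) 1) ∧
        pairGap ε (toTorus s) (toTorus t) ≤ r ^ 2} ≤ ENNReal.ofReal (C * r ^ 3) := by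
    -- Compactness of the cube turns the local bounds into a global one; constants add over a finite
    -- cover, and finitely many neighbourhoods of `s₀` intersect.
    refine hK.induction_on (p := fun S => ∃ C : ℝ, 0 ≤ C ∧ ∀ᶠ s in nhds s₀, ∀ r : ℝ, 0 < r →
      r ≤ 1 → volume {t | t ∈ S ∧ pairGap ε (toTorus s) (toTorus t) ≤ r ^ 2}
        ≤ ENNReal.ofReal (C * r ^ 3)) ?_ ?_ ?_ ?_
    · exact ⟨0, le_rfl, Filter.Eventually.of_forall fun s r _ _ => by simp⟩
    · rintro S S' hSS ⟨C, hC, h⟩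
      refine ⟨C, hC, h.mono fun s hs r hr hr1 => (measure_mono ?_).trans (hs r hr hr1)⟩
      exact fun t ht => ⟨hSS ht.1, ht.2⟩
    · rintro S S' ⟨C, hC, h⟩ ⟨C', hC', h'⟩
      refine ⟨C + C', add_nonneg hC hC', ?_⟩
      filter_upwards [h, h'] with s hs hs' r hr hr1
      have hsub : {t | t ∈ S ∪ S' ∧ pairGap ε (toTorus s) (toTorus t) ≤ r ^ 2}
          ⊆ {t | t ∈ S ∧ pairGap ε (toTorus s) (toTorus t) ≤ r ^ 2}
            ∪ {t | t ∈ S' ∧ pairGap ε (toTorus s) (toTorus t) ≤ r ^ 2} := by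
        rintro t ⟨h1 | h1, h2⟩
        · exact Or.inl ⟨h1, h2⟩
        · exact Or.inr ⟨h1, h2⟩
      refine (measure_mono hsub).trans ((measure_union_le _ _).trans
        ((add_le_add (hs r hr hr1) (hs' r hr hr1)).trans ?_))
      rw [← ENNReal.ofReal_add (by positivity) (by positivity), add_mul]
    · intro t₀ _
      obtain ⟨S, hS, C, hC, h⟩ := exists_volume_sublevel_le hd ε hε s₀ t₀ hM
      exact ⟨S, mem_nhdsWithin_of_mem_nhds hS, C, hC, h⟩
  obtain ⟨C, hC, h⟩ := hmain
  refine ⟨C, hC, ?_⟩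
  refine isOpenMap_toTorus.nhds_le s₀ (Filter.mem_map.2 ?_)
  filter_upwards [h] with s hs r hr hr1
  have hm : MeasurableSet {p | pairGap ε (toTorus s) p ≤ r ^ 2} :=
    measurableSet_le (pairGap ε (toTorus s)).continuous.measurable measurable_const
  refine le_trans ?_ (hs r hr hr1)
  rw [← measurePreserving_toTorus.measure_preimage hm.nullMeasurableSet,
    Measure.restrict_apply (measurePreserving_toTorus.measurable hm)]
  refine measure_mono fun t ht => ⟨fun i hi => ?_, ht.1⟩
  exact ⟨(ht.2 i hi).1.le, (ht.2 i hi).2⟩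

end PairGap

/-! ### Symmetric operators and Birman-Schwinger inequalities -/

section SymmetricOperators

variable {E : Type*} [NormedAddCommGroup E] [InnerProductSpace ℂ E]

/-- Symmetry passes to norm limits. This is needed at the threshold, where the symbol `1 / gap` is
not continuous and the operator is reached only as a limit of continuous multipliers. -/
theorem isSymmetric_of_norm_sub_le {T : E →ₗ[ℂ] E} (h : ∀ δ : ℝ, 0 < δ → ∃ S : E →ₗ[ℂ] E, S.IsSymmetric ∧
      ∀ f, ‖S f - T f‖ ≤ δ * ‖f‖) : T.IsSymmetric := by
  intro f g
  refine eq_of_forall_dist_le fun ρ hρ => ?_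
  obtain ⟨S, hS, hST⟩ := h (ρ / (2 * (‖f‖ * ‖g‖ + 1))) (by positivity)
  set δ := ρ / (2 * (‖f‖ * ‖g‖ + 1)) with hδ
  have h1 : inner ℂ (T f) g - inner ℂ f (T g)
      = inner ℂ f (S g - T g) - inner ℂ (S f - T f) g := by
    rw [inner_sub_left, inner_sub_right, hS f g]
    ring
  have h2 : ‖inner ℂ f (S g - T g)‖ ≤ ‖f‖ * (δ * ‖g‖) :=
    (norm_inner_le_norm _ _).trans (mul_le_mul_of_nonneg_left (hST g) (norm_nonneg _))
  have h3 : ‖inner ℂ (S f - T f) g‖ ≤ δ * ‖f‖ * ‖g‖ :=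
    (norm_inner_le_norm _ _).trans (mul_le_mul_of_nonneg_right (hST f) (norm_nonneg _))
  have h4 : δ * (2 * (‖f‖ * ‖g‖ + 1)) = ρ := by
    rw [hδ]
    field_simp
  have h5 : 0 < δ := by positivity
  rw [dist_eq_norm, h1]
  refine (norm_sub_le _ _).trans ?_
  nlinarith

theorem norm_eq_of_isSymmetric_of_involutive {D : E →ₗ[ℂ] E} (hD : D.IsSymmetric)
    (hDD : ∀ f, D (D f) = f) (f : E) : ‖D f‖ = ‖f‖ := by
  have h : inner ℂ (D f) (D f) = inner ℂ f f := by
    rw [hD f, hDD]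
  rw [inner_self_eq_norm_sq_to_K, inner_self_eq_norm_sq_to_K] at h
  have h2 : ‖D f‖ ^ 2 = ‖f‖ ^ 2 := by exact_mod_cast h
  exact (sq_eq_sq₀ (norm_nonneg _) (norm_nonneg _)).1 h2

theorem abs_re_inner_sub_le_of_norm_sub_le {T₁ T₂ : E →ₗ[ℂ] E} {c : ℝ} {f : E}
    (h : ‖T₁ f - T₂ f‖ ≤ c * ‖f‖) :
    |(inner ℂ f (T₁ f)).re - (inner ℂ f (T₂ f)).re| ≤ c * ‖f‖ ^ 2 := by
  rw [← Complex.sub_re, ← inner_sub_right]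
  refine (Complex.abs_re_le_norm _).trans ((norm_inner_le_norm _ _).trans ?_)
  have := mul_le_mul_of_nonneg_left h (norm_nonneg f)
  linarith

theorem inner_smul_comp_of_isSymmetric {D W M : E →ₗ[ℂ] E} (hD : D.IsSymmetric)
    (hW : W.IsSymmetric) (μ : ℝ) (f f' : E) :
    inner ℂ f (((μ : ℂ) • (D ∘ₗ W ∘ₗ M ∘ₗ W ∘ₗ D)) f')
      = (μ : ℂ) * inner ℂ (W (D f)) (M (W (D f'))) := by
  rw [hW (D f), hD f, LinearMap.smul_apply, inner_smul_right]
  rfl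

theorem isSymmetric_smul_comp {D W M : E →ₗ[ℂ] E} (hD : D.IsSymmetric) (hW : W.IsSymmetric)
    (hM : M.IsSymmetric) (μ : ℝ) : ((μ : ℂ) • (D ∘ₗ W ∘ₗ M ∘ₗ W ∘ₗ D)).IsSymmetric := by
  intro f f'
  rw [inner_smul_comp_of_isSymmetric hD hW, ← inner_conj_symm,
    inner_smul_comp_of_isSymmetric hD hW, map_mul, Complex.conj_ofReal, inner_conj_symm,
    hM (W (D f))]

/-- A Birman-Schwinger inequality: `2 μ ‖W f‖² ≤ ⟨f, A f⟩ + μ² ⟨W² f, A⁻¹ W² f⟩` for `A ≥ 0`. -/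
theorem two_mul_norm_sq_le {W A M : E →ₗ[ℂ] E} (hW : W.IsSymmetric) (hA : A.IsSymmetric)
    (hA0 : ∀ f, 0 ≤ (inner ℂ f (A f)).re) (hAM : ∀ f, A (M f) = f) (μ : ℝ) (f : E) :
    2 * μ * ‖W f‖ ^ 2 ≤ (inner ℂ f (A f)).re
      + μ ^ 2 * (inner ℂ (W (W f)) (M (W (W f)))).re := by
  set h := M (W (W f)) with hh
  have hAh : A h = W (W f) := hAM _
  have h1 : (inner ℂ f (W (W f))).re = ‖W f‖ ^ 2 := by
    rw [← hW f (W f), inner_self_eq_norm_sq_to_K]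
    norm_cast
  have h2 : (inner ℂ h (A f)).re = ‖W f‖ ^ 2 := by
    rw [← hA h f, hAh, ← inner_conj_symm, Complex.conj_re, h1]
  have h3 : (inner ℂ h (W (W f))).re = (inner ℂ (W (W f)) h).re := by
    rw [← inner_conj_symm, Complex.conj_re]
  -- The inequality is the nonnegativity of the form of `A` at `f - μ A⁻¹ W² f`, expanded.
  have h0 := hA0 (f - (μ : ℂ) • h)
  simp only [map_sub, map_smul, hAh, inner_sub_left, inner_sub_right, inner_smul_left,
    inner_smul_right, Complex.conj_ofReal, Complex.sub_re, Complex.re_ofReal_mul, h1, h2, h3] at h0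
  nlinarith

/-- If `‖φ‖² < μ ⟨W φ, A⁻¹ W φ⟩`, the trial function `f = A⁻¹ W φ` satisfies
`⟨f, A f⟩ < μ ‖W f‖²`. -/
theorem re_inner_lt_of_norm_sq_lt {W A M : E →ₗ[ℂ] E} (hW : W.IsSymmetric)
    (hAM : ∀ f, A (M f) = f) {μ : ℝ} (hμ : 0 < μ) {φ : E}
    (hφ : ‖φ‖ ^ 2 < μ * (inner ℂ (W φ) (M (W φ))).re) :
    (inner ℂ (M (W φ)) (A (M (W φ)))).re < μ * ‖W (M (W φ))‖ ^ 2 := by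
  set f := M (W φ) with hf
  have h1 : (inner ℂ f (W φ)).re = (inner ℂ (W φ) f).re := by
    rw [← inner_conj_symm, Complex.conj_re]
  have h2 : (inner ℂ φ (W f)).re = (inner ℂ (W φ) f).re := by rw [hW φ f]
  have h3 : (inner ℂ (W f) φ).re = (inner ℂ (W φ) f).re := by
    rw [← h2, ← inner_conj_symm, Complex.conj_re]
  have hn : ∀ x : E, (inner ℂ x x).re = ‖x‖ ^ 2 := fun x => by
    rw [inner_self_eq_norm_sq_to_K]
    norm_cast
  -- Expanding this square gives `2 μ ⟨φ, W f⟩ ≤ μ² ‖W f‖² + ‖φ‖²`, and by assumption `‖φ‖² < μ ⟨φ,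
  -- W f⟩`.
  have h0 : 0 ≤ (inner ℂ ((μ : ℂ) • W f - φ) ((μ : ℂ) • W f - φ)).re := by
    rw [hn]
    positivity
  simp only [inner_sub_left, inner_sub_right, inner_smul_left, inner_smul_right,
    Complex.conj_ofReal, Complex.sub_re, Complex.re_ofReal_mul, hn, h2, h3] at h0
  rw [hAM, h1]
  have h4 : μ * (inner ℂ (W φ) f).re < μ * (μ * ‖W f‖ ^ 2) := by nlinarith
  exact lt_of_mul_lt_mul_left h4 hμ.le

theorem re_inner_add_smul_of_eq_neg_comp {W I H₀ A : E →ₗ[ℂ] E} (hW : W.IsSymmetric)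
    (hI : ∀ f, I f = -W (W f)) {c : ℝ} (hA : ∀ f, H₀ f = A f + (c : ℂ) • f) (μ : ℝ) (f : E) :
    (inner ℂ f ((H₀ + (μ : ℂ) • I) f)).re
      = (inner ℂ f (A f)).re + c * ‖f‖ ^ 2 - μ * ‖W f‖ ^ 2 := by
  have hn : ∀ x : E, (inner ℂ x x).re = ‖x‖ ^ 2 := fun x => by
    rw [inner_self_eq_norm_sq_to_K]
    norm_cast
  have h1 : (inner ℂ f (W (W f))).re = ‖W f‖ ^ 2 := by rw [← hW f (W f), hn]
  simp only [LinearMap.add_apply, LinearMap.smul_apply, hI, hA, inner_add_right, inner_smul_right,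
    inner_neg_right, Complex.add_re, Complex.re_ofReal_mul, Complex.neg_re, hn, h1]
  ring

theorem isSymmetric_add_smul_of_eq_neg_comp {W I H₀ : E →ₗ[ℂ] E} (hW : W.IsSymmetric)
    (hI : ∀ f, I f = -W (W f)) (hH : H₀.IsSymmetric) (μ : ℝ) :
    (H₀ + (μ : ℂ) • I).IsSymmetric := by
  intro f g
  simp only [LinearMap.add_apply, LinearMap.smul_apply, hI, inner_add_right, inner_smul_right,
    inner_neg_right, inner_add_left, inner_smul_left, inner_neg_left, Complex.conj_ofReal]
  rw [hH f g, hW (W f) g, hW f (W g)]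

end SymmetricOperators

/-! ### Points of order two and the discontinuity of `half` -/

section Translations

variable {d : ℕ}

theorem mFourier_apply_add (x : Lattice d) (p q : Torus d) :
    UnitAddTorus.mFourier x (p + q) = UnitAddTorus.mFourier x p * UnitAddTorus.mFourier x q := by
  simp only [UnitAddTorus.mFourier, ContinuousMap.coe_mk, Pi.add_apply, fourier_apply, smul_add,
    AddCircle.toCircle_add, Circle.coe_mul, Finset.prod_mul_distrib]

theorem mFourier_apply_zero (x : Lattice d) : UnitAddTorus.mFourier x (0 : Torus d) = 1 := by
  simp [UnitAddTorus.mFourier]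

theorem norm_mFourier_apply (x : Lattice d) (p : Torus d) : ‖UnitAddTorus.mFourier x p‖ = 1 := by
  simp only [UnitAddTorus.mFourier, ContinuousMap.coe_mk, norm_prod, fourier_apply,
    Circle.norm_coe, Finset.prod_const_one]

/-- The character of `ℤᵈ` attached to a point of order two of the torus; its values are `±1`. -/
noncomputable def signChar (τ : Torus d) (x : Lattice d) : ℝ := (UnitAddTorus.mFourier x τ).re

theorem signChar_mul_self {τ : Torus d} (hτ : τ + τ = 0) (x : Lattice d) :
    (signChar τ x : ℂ) = UnitAddTorus.mFourier x τ ∧ signChar τ x * signChar τ x = 1 := by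
  have h : UnitAddTorus.mFourier x τ * UnitAddTorus.mFourier x τ = 1 := by
    rw [← mFourier_apply_add, hτ, mFourier_apply_zero]
  unfold signChar
  rcases mul_self_eq_one_iff.1 h with h | h <;> simp [h]

theorem signChar_neg {τ : Torus d} (hτ : τ + τ = 0) (x : Lattice d) :
    signChar τ (-x) = signChar τ x := by
  have h := mFourier_neg_neg (-x) τ
  rw [neg_neg, ← eq_neg_of_add_eq_zero_left hτ] at h
  unfold signChar
  rw [h]

theorem signChar_sub {τ : Torus d} (hτ : τ + τ = 0) (x y : Lattice d) :
    signChar τ (x - y) = signChar τ x * signChar τ y := by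
  have h : (signChar τ (x - y) : ℂ) = signChar τ x * signChar τ y := by
    rw [← signChar_neg hτ y, (signChar_mul_self hτ _).1, (signChar_mul_self hτ _).1,
      (signChar_mul_self hτ _).1, sub_eq_add_neg, UnitAddTorus.mFourier_add]
  exact_mod_cast h

theorem abs_signChar_le {τ : Torus d} (hτ : τ + τ = 0) : ∃ C, ∀ x, |signChar τ x| ≤ C :=
  ⟨1, fun x => abs_le_one_iff_mul_self_le_one.2 (signChar_mul_self hτ x).2.le⟩

/-- Multiplication by the character of a point of order two. -/
noncomputable def signOp (τ : Torus d) (hτ : τ + τ = 0) : Module.End ℂ (evenL2 d) :=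
  diag (signChar τ) (abs_signChar_le hτ) (signChar_neg hτ)

theorem signOp_signOp {τ : Torus d} (hτ : τ + τ = 0) (f : evenL2 d) :
    signOp τ hτ (signOp τ hτ f) = f := by
  refine evenL2_ext fun x => ?_
  have h : (signChar τ x : ℂ) * signChar τ x = 1 := by exact_mod_cast (signChar_mul_self hτ x).2
  change (signChar τ x : ℂ) * ((signChar τ x : ℂ) * (f : L2 d) x) = (f : L2 d) x
  rw [← mul_assoc, h, one_mul]

theorem norm_signOp {τ : Torus d} (hτ : τ + τ = 0) (f : evenL2 d) : ‖signOp τ hτ f‖ = ‖f‖ :=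
  norm_eq_of_isSymmetric_of_involutive (diag_isSymmetric _ _ _) (signOp_signOp hτ) f

instance haar_isAddLeftInvariant (d : ℕ) : (haar d).IsAddLeftInvariant := by
  unfold haar; infer_instance

/-- Since `-τ = τ`, the two arguments `h + τ + p` and `h + τ - p` equal `h + (p + τ)` and `h - (p +
τ)`. -/
theorem pairSum_add_of_order_two (ε : C(Torus d, ℝ)) (h : Torus d) {τ : Torus d}
    (hτ : τ + τ = 0) (p : Torus d) : pairSum ε (h + τ) p = pairSum ε h (p + τ) := by
  rw [pairSum_apply, pairSum_apply]
  have h1 : h - (p + τ) = h + τ - p := by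
    rw [eq_neg_of_add_eq_zero_left hτ]
    nth_rewrite 1 [eq_neg_of_add_eq_zero_left hτ]
    abel
  rw [h1]
  congr 2
  abel

theorem pairGap_add_of_order_two (ε : C(Torus d, ℝ)) (h : Torus d) {τ : Torus d}
    (hτ : τ + τ = 0) (p : Torus d) : pairGap ε (h + τ) p = pairGap ε h (p + τ) := by
  rw [pairGap_apply, pairGap_apply, pairSum_add_of_order_two ε h hτ]
  congr 1
  exact (Equiv.addRight τ).iInf_congr fun q => (pairSum_add_of_order_two ε h hτ q).symm

theorem pairGap_neg (ε : C(Torus d, ℝ)) (h p : Torus d) :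
    pairGap ε h (-p) = pairGap ε h p := by
  rw [pairGap_apply, pairGap_apply, pairSum_apply, pairSum_apply, sub_neg_eq_add,
    ← sub_eq_add_neg, add_comm (ε (h - p))]

theorem half_add_half (k : Torus d) : half k + half k = k := by
  funext i
  change (((AddCircle.equivIco (1 : ℝ) (-(1 / 2)) (k i) : ℝ) / 2 : ℝ) : UnitAddCircle)
    + (((AddCircle.equivIco (1 : ℝ) (-(1 / 2)) (k i) : ℝ) / 2 : ℝ) : UnitAddCircle) = k i
  rw [← AddCircle.coe_add, add_halves]
  exact (AddCircle.equivIco (1 : ℝ) (-(1 / 2))).symm_apply_apply (k i)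

/-- Up to a point of order two, `half` is continuous. -/
theorem eventually_half_add_mem (k₀ : Torus d) {N : Set (Torus d)} (hN : N ∈ nhds (half k₀)) :
    ∀ᶠ k in nhds k₀, ∃ τ : Torus d, τ + τ = 0 ∧ half k + τ ∈ N := by
  obtain ⟨s, hs⟩ := exists_toTorus_eq (half k₀)
  have hk : toTorus (s + s) = k₀ := by rw [toTorus_add, hs, half_add_half]
  have hcont : Continuous fun u : Fin d → ℝ => toTorus ((1 / 2 : ℝ) • u) :=
    continuous_toTorus.comp (continuous_const_smul _)
  have hhalf : (1 / 2 : ℝ) • (s + s) = s := by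
    rw [← two_smul ℝ s, smul_smul]
    norm_num
  have hev : ∀ᶠ u in nhds (s + s), toTorus ((1 / 2 : ℝ) • u) ∈ N := by
    refine hcont.continuousAt.eventually_mem ?_
    rw [hhalf, hs]
    exact hN
  rw [← hk]
  refine isOpenMap_toTorus.nhds_le (s + s) (Filter.mem_map.2 ?_)
  filter_upwards [hev] with u hu
  have h2 : toTorus ((1 / 2 : ℝ) • u) + toTorus ((1 / 2 : ℝ) • u) = toTorus u := by
    rw [← toTorus_add, ← add_smul]
    norm_num
  -- `τ` compares `half` with the continuous local branch `u ↦ u / 2`; both double to the same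
  -- point, so `2τ = 0`.
  refine ⟨toTorus ((1 / 2 : ℝ) • u) - half (toTorus u), ?_, ?_⟩
  · rw [sub_add_sub_comm, h2, half_add_half, sub_self]
  · rwa [add_sub_cancel]

end Translations

/-! ### Convolution kernels between square roots of the potential -/

section Sandwich

variable {d : ℕ}

/-- `T` has the kernel `|v(x)|^{1/2} r(x - y) |v(y)|^{1/2}`. -/
def IsSandwich (v : PairPotential d) (r : Lattice d → ℂ) (T : Module.End ℂ (evenL2 d)) : Prop :=
  ∀ (f : evenL2 d) (x : Lattice d), HasSum (fun y =>
    ((√|v.toFun x| : ℝ) : ℂ) * r (x - y) * ((√|v.toFun y| : ℝ) : ℂ) * (f : L2 d) y)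
    ((T f : L2 d) x)

theorem summable_sqrt_sq (v : PairPotential d) : Summable fun y => √|v.toFun y| ^ 2 := by
  simp only [Real.sq_sqrt (abs_nonneg _)]
  exact v.summable.abs

/-- The difference kernel is dominated by `δ |v(x)|^{1/2} |v(y)|^{1/2}`, a product of
square-summable functions. Thus uniform closeness of `r₁` and `r₂` is enough for closeness in norm.
-/
theorem IsSandwich.norm_sub_le {v : PairPotential d} {r₁ r₂ : Lattice d → ℂ}
    {T₁ T₂ : Module.End ℂ (evenL2 d)} (h₁ : IsSandwich v r₁ T₁) (h₂ : IsSandwich v r₂ T₂)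
    {δ : ℝ} (hδ : 0 ≤ δ) (h : ∀ x, ‖r₁ x - r₂ x‖ ≤ δ) (f : evenL2 d) :
    ‖T₁ f - T₂ f‖ ≤ δ * (∑' y, |v.toFun y|) * ‖f‖ := by
  have hsum := summable_sqrt_sq v
  have hA : ∑' y, √|v.toFun y| ^ 2 = ∑' y, |v.toFun y| := by
    simp only [Real.sq_sqrt (abs_nonneg _)]
  have ha : Summable fun y => (δ * √|v.toFun y|) ^ 2 := by
    simp only [mul_pow]
    exact hsum.mul_left _
  have hle := norm_le_of_kernel_le (a := fun y => δ * √|v.toFun y|) (b := fun y => √|v.toFun y|)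
    (K := fun x y => ((√|v.toFun x| : ℝ) : ℂ) * (r₁ (x - y) - r₂ (x - y))
      * ((√|v.toFun y| : ℝ) : ℂ)) (fun y => by positivity) ha (fun y => by positivity) hsum
    (fun x y => by
      simp only [norm_mul, Complex.norm_real, Real.norm_eq_abs, abs_of_nonneg (Real.sqrt_nonneg _)]
      have := mul_le_mul_of_nonneg_left (h (x - y))
        (by positivity : 0 ≤ √|v.toFun x| * √|v.toFun y|)
      linarith)
    (f := (f : L2 d)) (g := ((T₁ f - T₂ f : evenL2 d) : L2 d)) (fun x => by
      refine ((((h₁ f x).sub (h₂ f x)).congr_fun fun y => ?_).tsum_eq).symm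
      ring)
  have h3 : √(∑' y, (δ * √|v.toFun y|) ^ 2) * √(∑' y, √|v.toFun y| ^ 2)
      = δ * ∑' y, |v.toFun y| := by
    have h0 : 0 ≤ ∑' y, |v.toFun y| := tsum_nonneg fun y => abs_nonneg _
    simp only [mul_pow, tsum_mul_left, hA]
    rw [Real.sqrt_mul (by positivity), Real.sqrt_sq hδ, mul_assoc, Real.mul_self_sqrt h0]
  rw [h3] at hle
  exact hle

theorem IsSandwich.abs_re_inner_sub_le {v : PairPotential d} {r₁ r₂ : Lattice d → ℂ}
    {T₁ T₂ : Module.End ℂ (evenL2 d)} (h₁ : IsSandwich v r₁ T₁) (h₂ : IsSandwich v r₂ T₂)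
    {δ : ℝ} (hδ : 0 ≤ δ) (h : ∀ x, ‖r₁ x - r₂ x‖ ≤ δ) (f : evenL2 d) :
    |(inner ℂ f (T₁ f)).re - (inner ℂ f (T₂ f)).re| ≤ δ * (∑' y, |v.toFun y|) * ‖f‖ ^ 2 :=
  abs_re_inner_sub_le_of_norm_sub_le (h₁.norm_sub_le h₂ hδ h f)

theorem IsSandwich.isCompactOperator {v : PairPotential d} {r : Lattice d → ℂ}
    {T : evenL2 d →L[ℂ] evenL2 d} (h : IsSandwich v r T.toLinearMap) {C : ℝ}
    (hr : ∀ x, ‖r x‖ ≤ C) : IsCompactOperator T := by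
  have hC : 0 ≤ C := (norm_nonneg _).trans (hr 0)
  have hsum := summable_sqrt_sq v
  have ha : Summable fun y => (C * √|v.toFun y|) ^ 2 := by
    simp only [mul_pow]
    exact hsum.mul_left _
  refine isCompactOperator_of_kernel_le (a := fun y => C * √|v.toFun y|)
    (b := fun y => √|v.toFun y|) (K := fun x y => ((√|v.toFun x| : ℝ) : ℂ) * r (x - y)
      * ((√|v.toFun y| : ℝ) : ℂ)) (fun y => by positivity) ha (fun y => by positivity) hsum
    (fun x y => ?_) T (fun f x => (h f x).tsum_eq.symm)
  simp only [norm_mul, Complex.norm_real, Real.norm_eq_abs, abs_of_nonneg (Real.sqrt_nonneg _)]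
  have := mul_le_mul_of_nonneg_left (hr (x - y)) (by positivity : 0 ≤ √|v.toFun x| * √|v.toFun y|)
  linarith

theorem isSandwich_birmanSchwinger (ε : C(Torus d, ℝ)) (v : PairPotential d) (μ : ℝ)
    (k : Torus d) :
    IsSandwich v (fun x => (μ : ℂ) * thresholdResolvent ε k x) (birmanSchwinger ε v μ k) := by
  intro f x
  obtain ⟨C, hC⟩ := birmanSchwingerKernel_term_le ε v μ k
  have hs : Summable fun y => birmanSchwingerKernel ε v μ k x y * (f : L2 d) y :=
    Summable.of_norm_bounded ((summable_sqrt_mul v f).mul_left _) (hC f x)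
  refine hs.hasSum.congr_fun fun y => ?_
  unfold birmanSchwingerKernel
  ring

/-- Multiplication by `|v|^{1/2}`. -/
noncomputable def sqrtPotential (v : PairPotential d) : Module.End ℂ (evenL2 d) :=
  diag (fun x => √|v.toFun x|) ⟨√(∑' y, |v.toFun y|), fun x => by
    rw [abs_of_nonneg (Real.sqrt_nonneg _)]
    exact Real.sqrt_le_sqrt (v.abs_le x)⟩ (fun x => by simp only [v.even])

theorem sqrtPotential_isSymmetric (v : PairPotential d) : (sqrtPotential v).IsSymmetric :=
  diag_isSymmetric _ _ _

theorem interaction_eq (v : PairPotential d) (f : evenL2 d) :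
    interaction v f = -sqrtPotential v (sqrtPotential v f) := by
  refine evenL2_ext fun x => ?_
  have h : ((√|v.toFun x| : ℝ) : ℂ) * ((√|v.toFun x| : ℝ) : ℂ) = -(v.toFun x : ℂ) := by
    rw [← Complex.ofReal_mul, Real.mul_self_sqrt (abs_nonneg _), abs_of_nonpos (v.nonpos x),
      Complex.ofReal_neg]
  change (v.toFun x : ℂ) * (f : L2 d) x
    = -(((√|v.toFun x| : ℝ) : ℂ) * (((√|v.toFun x| : ℝ) : ℂ) * (f : L2 d) x))
  rw [← mul_assoc, h]
  ring

/-- `μ D W M_g W D`, where `W` is multiplication by `|v|^{1/2}` and `D` by the character of `τ`. -/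
noncomputable def sandwich (v : PairPotential d) (μ : ℝ) (τ : Torus d) (hτ : τ + τ = 0)
    (g : C(Torus d, ℝ)) (hg : ∀ p, g (-p) = g p) : Module.End ℂ (evenL2 d) :=
  (μ : ℂ) • (signOp τ hτ ∘ₗ sqrtPotential v ∘ₗ evenMultiplier g hg ∘ₗ sqrtPotential v ∘ₗ
    signOp τ hτ)

/-- As the character is multiplicative and `±1`-valued, conjugation by it multiplies the convolution
kernel by its value at `x - y`. -/
theorem isSandwich_sandwich (v : PairPotential d) (μ : ℝ) (τ : Torus d) (hτ : τ + τ = 0)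
    (g : C(Torus d, ℝ)) (hg : ∀ p, g (-p) = g p) :
    IsSandwich v (fun x => (μ : ℂ) * ((signChar τ x : ℂ) * symbolCoeff g x))
      (sandwich v μ τ hτ g hg) := by
  intro f x
  have h := (hasSum_multiplier g (sqrtPotential v (signOp τ hτ f) : evenL2 d) x).mul_left
    ((μ : ℂ) * ((signChar τ x : ℂ) * ((√|v.toFun x| : ℝ) : ℂ)))
  have h2 : ((sandwich v μ τ hτ g hg f : evenL2 d) : L2 d) x
      = ((μ : ℂ) * ((signChar τ x : ℂ) * ((√|v.toFun x| : ℝ) : ℂ)))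
        * multiplier g ((sqrtPotential v (signOp τ hτ f) : evenL2 d) : L2 d) x := by
    change (μ : ℂ) * ((signChar τ x : ℂ) * (((√|v.toFun x| : ℝ) : ℂ)
      * multiplier g ((sqrtPotential v (signOp τ hτ f) : evenL2 d) : L2 d) x)) = _
    ring
  rw [h2]
  refine h.congr_fun fun y => ?_
  change ((√|v.toFun x| : ℝ) : ℂ) * ((μ : ℂ) * ((signChar τ (x - y) : ℂ) * symbolCoeff g (x - y)))
      * ((√|v.toFun y| : ℝ) : ℂ) * (f : L2 d) y = (μ : ℂ) * ((signChar τ x : ℂ)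
      * ((√|v.toFun x| : ℝ) : ℂ)) * (symbolCoeff g (x - y)
      * (((√|v.toFun y| : ℝ) : ℂ) * ((signChar τ y : ℂ) * (f : L2 d) y)))
  rw [signChar_sub hτ, Complex.ofReal_mul]
  ring

theorem inner_sandwich (v : PairPotential d) (μ : ℝ) (τ : Torus d) (hτ : τ + τ = 0)
    (g : C(Torus d, ℝ)) (hg : ∀ p, g (-p) = g p) (f f' : evenL2 d) :
    inner ℂ f (sandwich v μ τ hτ g hg f') = (μ : ℂ) * inner ℂ (sqrtPotential v (signOp τ hτ f))
      (evenMultiplier g hg (sqrtPotential v (signOp τ hτ f'))) :=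
  inner_smul_comp_of_isSymmetric (diag_isSymmetric _ _ _) (sqrtPotential_isSymmetric v) μ f f'

theorem sandwich_isSymmetric (v : PairPotential d) (μ : ℝ) (τ : Torus d) (hτ : τ + τ = 0)
    (g : C(Torus d, ℝ)) (hg : ∀ p, g (-p) = g p) : (sandwich v μ τ hτ g hg).IsSymmetric :=
  isSymmetric_smul_comp (diag_isSymmetric _ _ _) (sqrtPotential_isSymmetric v)
    (evenMultiplier_isSymmetric g hg) μ

end Sandwich

/-! ### Continuity at the threshold and transfer to the Schrödinger operator -/

section Threshold

variable {d : ℕ}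

/-- The pair gap shifted by `s`. -/
noncomputable def shiftedGap (ε : C(Torus d, ℝ)) (h : Torus d) (s : ℝ) : C(Torus d, ℝ) :=
  pairGap ε h + ContinuousMap.const _ s

theorem shiftedGap_apply (ε : C(Torus d, ℝ)) (h : Torus d) (s : ℝ) (p : Torus d) :
    shiftedGap ε h s p = pairGap ε h p + s := rfl

theorem shiftedGap_pos (ε : C(Torus d, ℝ)) (h : Torus d) {s : ℝ} (hs : 0 < s) (p : Torus d) :
    0 < shiftedGap ε h s p :=
  add_pos_of_nonneg_of_pos (pairGap_nonneg ε h p) hs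

theorem shiftedGap_neg (ε : C(Torus d, ℝ)) (h : Torus d) (s : ℝ) (p : Torus d) :
    shiftedGap ε h s (-p) = shiftedGap ε h s p := by
  rw [shiftedGap_apply, shiftedGap_apply, pairGap_neg]

/-- The symbol of the resolvent at distance `s` below the threshold. -/
noncomputable def resolventSymbol (ε : C(Torus d, ℝ)) (h : Torus d) {s : ℝ} (hs : 0 < s) :
    C(Torus d, ℝ) :=
  ⟨fun p => (shiftedGap ε h s p)⁻¹,
    (shiftedGap ε h s).continuous.inv₀ fun p => (shiftedGap_pos ε h hs p).ne'⟩

theorem resolventSymbol_apply (ε : C(Torus d, ℝ)) (h : Torus d) {s : ℝ} (hs : 0 < s)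
    (p : Torus d) : resolventSymbol ε h hs p = (pairGap ε h p + s)⁻¹ := rfl

theorem resolventSymbol_neg (ε : C(Torus d, ℝ)) (h : Torus d) {s : ℝ} (hs : 0 < s)
    (p : Torus d) : resolventSymbol ε h hs (-p) = resolventSymbol ε h hs p := by
  rw [resolventSymbol_apply, resolventSymbol_apply, pairGap_neg]

theorem evenMultiplier_shiftedGap_resolventSymbol (ε : C(Torus d, ℝ)) (h : Torus d) {s : ℝ}
    (hs : 0 < s) (f : evenL2 d) :
    evenMultiplier (shiftedGap ε h s) (shiftedGap_neg ε h s)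
      (evenMultiplier (resolventSymbol ε h hs) (resolventSymbol_neg ε h hs) f) = f := by
  apply Subtype.ext
  rw [coe_evenMultiplier, coe_evenMultiplier, ← multiplier_mul]
  have h1 : shiftedGap ε h s * resolventSymbol ε h hs = ContinuousMap.const _ 1 := by
    ext p
    exact mul_inv_cancel₀ (shiftedGap_pos ε h hs p).ne'
  rw [h1, multiplier_const, Complex.ofReal_one, one_smul]

theorem freeOperator_eq_shiftedGap_add (ε : C(Torus d, ℝ)) (k : Torus d) (s : ℝ)
    (f : evenL2 d) :
    freeOperator ε k f = evenMultiplier (shiftedGap ε (half k) s) (shiftedGap_neg ε (half k) s) f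
      + ((threshold ε k - s : ℝ) : ℂ) • f := by
  have h1 : shiftedGap ε (half k) s
      = pairDispersion ε k - ContinuousMap.const _ (threshold ε k - s) := by
    ext p
    change pairDispersion ε k p - threshold ε k + s = pairDispersion ε k p - (threshold ε k - s)
    ring
  apply Subtype.ext
  change (freeOperator ε k f : L2 d) = multiplier (shiftedGap ε (half k) s) f
    + ((threshold ε k - s : ℝ) : ℂ) • (f : L2 d)
  rw [freeOperator_eq, coe_evenMultiplier, h1, multiplier_sub, multiplier_const, sub_add_cancel]

theorem schrodinger_isSymmetric (ε : C(Torus d, ℝ)) (v : PairPotential d) (μ : ℝ)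
    (k : Torus d) : (schrodinger ε v μ k).IsSymmetric := by
  refine isSymmetric_add_smul_of_eq_neg_comp (sqrtPotential_isSymmetric v) (interaction_eq v) ?_ μ
  rw [freeOperator_eq]
  exact evenMultiplier_isSymmetric _ _

theorem re_inner_schrodinger (ε : C(Torus d, ℝ)) (v : PairPotential d) (μ : ℝ) (k : Torus d)
    (s : ℝ) (f : evenL2 d) :
    (inner ℂ f (schrodinger ε v μ k f)).re
      = (inner ℂ f (evenMultiplier (shiftedGap ε (half k) s) (shiftedGap_neg ε (half k) s) f)).re
        + (threshold ε k - s) * ‖f‖ ^ 2 - μ * ‖sqrtPotential v f‖ ^ 2 :=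
  re_inner_add_smul_of_eq_neg_comp (sqrtPotential_isSymmetric v) (interaction_eq v)
    (freeOperator_eq_shiftedGap_add ε k s) μ f

/-- Adding a point of order two to `h` multiplies the resolvent kernel by a character. -/
theorem symbolCoeff_resolventSymbol_add (ε : C(Torus d, ℝ)) (h : Torus d) {τ : Torus d}
    (hτ : τ + τ = 0) {s : ℝ} (hs : 0 < s) (x : Lattice d) :
    symbolCoeff (resolventSymbol ε (h + τ) hs) x
      = (signChar τ x : ℂ) * symbolCoeff (resolventSymbol ε h hs) x := by
  have h1 : (signChar τ x : ℂ) = UnitAddTorus.mFourier (-x) τ := by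
    rw [← signChar_neg hτ, (signChar_mul_self hτ _).1]
  unfold symbolCoeff
  rw [h1, ← integral_const_mul]
  refine Eq.trans ?_ (integral_add_right_eq_self (μ := haar d) (fun p =>
    UnitAddTorus.mFourier (-x) τ * (UnitAddTorus.mFourier (-x) p * (resolventSymbol ε h hs p : ℂ)))
    τ)
  refine integral_congr_ae (Filter.Eventually.of_forall fun p => ?_)
  have h2 : UnitAddTorus.mFourier (-x) p
      = UnitAddTorus.mFourier (-x) τ * UnitAddTorus.mFourier (-x) (p + τ) := by
    rw [← mFourier_apply_add, add_left_comm, hτ, add_zero]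
  simp only [resolventSymbol_apply, pairGap_add_of_order_two ε h hτ]
  rw [h2, mul_assoc]

theorem thresholdResolvent_eq (ε : C(Torus d, ℝ)) (k : Torus d) (x : Lattice d) :
    thresholdResolvent ε k x
      = ∫ q, UnitAddTorus.mFourier (-x) q * (((pairGap ε (half k) q)⁻¹ : ℝ) : ℂ) ∂haar d := by
  rw [← thresholdResolvent_neg]
  unfold thresholdResolvent
  refine integral_congr_ae (Filter.Eventually.of_forall fun q => ?_)
  simp only [Complex.ofReal_inv, div_eq_mul_inv]
  rfl

/-- Characters have modulus one, so the `L¹` distance of the symbols controls all Fourier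
coefficients at once, uniformly in `x`. -/
theorem norm_symbolCoeff_sub_thresholdResolvent_le (ε : C(Torus d, ℝ)) (k h : Torus d) {s : ℝ}
    (hs : 0 < s) (hint : Integrable (fun q => (pairGap ε (half k) q)⁻¹) (haar d))
    (x : Lattice d) :
    ‖symbolCoeff (resolventSymbol ε h hs) x - thresholdResolvent ε k x‖
      ≤ ∫ q, |(pairGap ε h q + s)⁻¹ - (pairGap ε (half k) q)⁻¹| ∂haar d := by
  have hb : ∀ g : Torus d → ℝ, Integrable g (haar d) →
      Integrable (fun q => UnitAddTorus.mFourier (-x) q * (g q : ℂ)) (haar d) := by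
    intro g hg
    refine hg.ofReal.bdd_mul (c := 1)
      (UnitAddTorus.mFourier (-x)).continuous.aestronglyMeasurable
      (Filter.Eventually.of_forall fun q => (norm_mFourier_apply (-x) q).le)
  have hint' : Integrable (resolventSymbol ε h hs) (haar d) :=
    (resolventSymbol ε h hs).continuous.integrable_of_hasCompactSupport
      (HasCompactSupport.of_compactSpace _)
  rw [thresholdResolvent_eq]
  unfold symbolCoeff
  rw [← integral_sub (hb _ hint') (hb _ hint)]
  refine (norm_integral_le_integral_norm _).trans (le_of_eq ?_)
  refine integral_congr_ae (Filter.Eventually.of_forall fun q => ?_)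
  simp only [← mul_sub, norm_mul, norm_mFourier_apply, one_mul, ← Complex.ofReal_sub,
    Complex.norm_real, Real.norm_eq_abs, resolventSymbol_apply]

/-- Continuity of the resolvent kernel at the threshold, jointly in the quasi-momentum and the
spectral parameter. -/
theorem exists_norm_symbolCoeff_sub_le (hd : 3 ≤ d) {ε : C(Torus d, ℝ)}
    (hε : ContDiff ℝ 2 (ε ∘ toTorus)) {k₀ : Torus d} (hM : IsMorse (pairDispersion ε k₀)) {ρ : ℝ}
    (hρ : 0 < ρ) : ∃ N ∈ nhds (half k₀), ∃ s₀ : ℝ, 0 < s₀ ∧ ∀ h ∈ N, ∀ s : ℝ, ∀ hs : 0 < s,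
      s ≤ s₀ → ∀ x,
        ‖symbolCoeff (resolventSymbol ε h hs) x - thresholdResolvent ε k₀ x‖ ≤ ρ := by
  obtain ⟨C, hC, hev⟩ := exists_sublevelBound_pairGap hd ε hε (half k₀) hM
  obtain ⟨δ, hδ, hclose⟩ := SublevelBound.exists_integral_abs_inv_sub_inv_le (X := Torus d) hC hρ
  have hball := Metric.tendsto_nhds.1 ((continuous_pairGap ε).tendsto (half k₀)) (δ / 2)
    (by positivity)
  -- Half of `δ` pays for moving the quasi-momentum, half for the shift by `s`. The shift only
  -- shrinks sublevel sets, so the constant `C` is unchanged.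
  refine ⟨_, hev.and hball, δ / 2, by positivity, fun h hh s hs hs0 x => ?_⟩
  have h0 : SublevelBound (haar d) (pairGap ε (half k₀)) C := hev.self_of_nhds
  refine (norm_symbolCoeff_sub_thresholdResolvent_le ε k₀ h hs (h0.integrable_inv hC
    (pairGap_nonneg ε _) (pairGap ε _).continuous.measurable) x).trans ?_
  refine hclose (haar d) (fun q => pairGap ε h q + s) (pairGap ε (half k₀)) (fun r hr hr1 => ?_) h0
    (fun q => add_nonneg (pairGap_nonneg ε h q) hs.le) (pairGap_nonneg ε _)
    ((pairGap ε h).continuous.measurable.add_const s) (pairGap ε _).continuous.measurable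
    fun q => ?_
  · refine (measure_mono fun q hq => ?_).trans (hh.1 r hr hr1)
    have hq' : pairGap ε h q + s ≤ r ^ 2 := hq
    change pairGap ε h q ≤ r ^ 2
    linarith
  · have h1 : |pairGap ε h q - pairGap ε (half k₀) q| ≤ δ / 2 :=
      (ContinuousMap.dist_apply_le_dist q).trans hh.2.le
    have h2 := abs_le.1 h1
    rw [abs_le]
    constructor <;> linarith

/-- The kernel of the Birman-Schwinger operator is continuous up to the threshold. -/
theorem exists_norm_mul_symbolCoeff_sub_le (hd : 3 ≤ d) {ε : C(Torus d, ℝ)}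
    (hε : ContDiff ℝ 2 (ε ∘ toTorus)) {k₀ : Torus d} (hM : IsMorse (pairDispersion ε k₀))
    (μ₀ : ℝ) {ρ : ℝ} (hρ : 0 < ρ) : ∃ N ∈ nhds (half k₀), ∃ s₀ : ℝ, 0 < s₀ ∧ ∃ m : ℝ, 0 < m ∧
      ∀ h ∈ N, ∀ s : ℝ, ∀ hs : 0 < s, s ≤ s₀ → ∀ μ : ℝ, |μ - μ₀| ≤ m → ∀ x,
        ‖(μ : ℂ) * symbolCoeff (resolventSymbol ε h hs) x
          - (μ₀ : ℂ) * thresholdResolvent ε k₀ x‖ ≤ ρ := by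
  obtain ⟨R, hR⟩ := exists_norm_thresholdResolvent_le ε k₀
  have hR0 : 0 ≤ R := (norm_nonneg _).trans (hR 0)
  obtain ⟨N, hN, s₀, hs₀, h⟩ := exists_norm_symbolCoeff_sub_le hd hε hM
    (ρ := ρ / (2 * (|μ₀| + 1))) (by positivity)
  refine ⟨N, hN, s₀, hs₀, min 1 (ρ / (2 * (R + 1))), by positivity, ?_⟩
  intro k hk s hs hs0 μ hμ x
  have h1 := h k hk s hs hs0 x
  have h2 : (μ : ℂ) * symbolCoeff (resolventSymbol ε k hs) x - (μ₀ : ℂ) * thresholdResolvent ε k₀ x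
      = (μ : ℂ) * (symbolCoeff (resolventSymbol ε k hs) x - thresholdResolvent ε k₀ x)
        + ((μ - μ₀ : ℝ) : ℂ) * thresholdResolvent ε k₀ x := by
    push_cast
    ring
  have hμ1 : |μ| ≤ |μ₀| + 1 := by
    have h3 := abs_sub_abs_le_abs_sub μ μ₀
    have h4 := hμ.trans (min_le_left _ _)
    linarith
  rw [h2]
  refine (norm_add_le _ _).trans ?_
  rw [norm_mul, norm_mul, Complex.norm_real, Complex.norm_real, Real.norm_eq_abs,
    Real.norm_eq_abs]
  have h5 : |μ| * ‖symbolCoeff (resolventSymbol ε k hs) x - thresholdResolvent ε k₀ x‖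
      ≤ (|μ₀| + 1) * (ρ / (2 * (|μ₀| + 1))) :=
    mul_le_mul hμ1 h1 (norm_nonneg _) (by positivity)
  have h6 : |μ - μ₀| * ‖thresholdResolvent ε k₀ x‖ ≤ ρ / (2 * (R + 1)) * (R + 1) :=
    mul_le_mul (hμ.trans (min_le_right _ _)) ((hR x).trans (by linarith)) (norm_nonneg _)
      (by positivity)
  have h7 : (|μ₀| + 1) * (ρ / (2 * (|μ₀| + 1))) = ρ / 2 := by field_simp
  have h8 : ρ / (2 * (R + 1)) * (R + 1) = ρ / 2 := by field_simp
  linarith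

/-- The threshold operator is the norm limit of the symmetric operators below the threshold, taken
with trivial shift `τ = 0`. -/
theorem birmanSchwinger_isSymmetric (hd : 3 ≤ d) {ε : C(Torus d, ℝ)}
    (hε : ContDiff ℝ 2 (ε ∘ toTorus)) {k₀ : Torus d} (hM : IsMorse (pairDispersion ε k₀))
    (v : PairPotential d) (μ₀ : ℝ) : (birmanSchwinger ε v μ₀ k₀).IsSymmetric := by
  refine isSymmetric_of_norm_sub_le fun δ hδ => ?_
  have hA : 0 ≤ ∑' y, |v.toFun y| := tsum_nonneg fun y => abs_nonneg _
  obtain ⟨N, hN, s, hs, m, hm, h⟩ := exists_norm_mul_symbolCoeff_sub_le hd hε hM μ₀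
    (ρ := δ / (∑' y, |v.toFun y| + 1)) (by positivity)
  have hτ : (0 : Torus d) + 0 = 0 := add_zero 0
  refine ⟨_, sandwich_isSymmetric v μ₀ 0 hτ (resolventSymbol ε (half k₀) hs)
    (resolventSymbol_neg ε _ hs), fun f => ?_⟩
  refine ((isSandwich_sandwich v μ₀ 0 hτ (resolventSymbol ε (half k₀) hs)
    (resolventSymbol_neg ε _ hs)).norm_sub_le (isSandwich_birmanSchwinger ε v μ₀ k₀)
    (δ := δ / (∑' y, |v.toFun y| + 1)) (by positivity) (fun x => ?_) f).trans ?_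
  · rw [← symbolCoeff_resolventSymbol_add ε _ hτ hs, add_zero]
    exact h _ (mem_of_mem_nhds hN) s hs le_rfl μ₀ (by simpa using hm.le) x
  · refine mul_le_mul_of_nonneg_right ?_ (norm_nonneg _)
    rw [div_mul_eq_mul_div, div_le_iff₀ (by positivity)]
    exact mul_le_mul_of_nonneg_left (by linarith) hδ.le

theorem exists_gap_birmanSchwinger (hd : 3 ≤ d) {ε : C(Torus d, ℝ)}
    (hε : ContDiff ℝ 2 (ε ∘ toTorus)) {k₀ : Torus d} (hM : IsMorse (pairDispersion ε k₀))
    (v : PairPotential d) (μ₀ : ℝ) (hreg : IsRegularPoint ε v μ₀ k₀) :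
    ∃ (V : Submodule ℂ (evenL2 d)) (S : evenL2 d →ₗ[ℂ] V) (δ : ℝ), FiniteDimensional ℂ V ∧ 0 < δ ∧
      (∀ f, S f = 0 →
        δ * ‖f‖ ^ 2 ≤ ‖f‖ ^ 2 - (inner ℂ f (birmanSchwinger ε v μ₀ k₀ f)).re) ∧
      ∀ f ∈ V, δ * ‖f‖ ^ 2 ≤ (inner ℂ f (birmanSchwinger ε v μ₀ k₀ f)).re - ‖f‖ ^ 2 := by
  have hsymm := birmanSchwinger_isSymmetric hd hε hM v μ₀
  let B : evenL2 d →L[ℂ] evenL2 d := ⟨birmanSchwinger ε v μ₀ k₀, hsymm.continuous⟩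
  obtain ⟨R, hR⟩ := exists_norm_thresholdResolvent_le ε k₀
  have hc : IsCompactOperator B := IsSandwich.isCompactOperator (v := v) (C := |μ₀| * R)
    (isSandwich_birmanSchwinger ε v μ₀ k₀) fun x => by
      rw [norm_mul, Complex.norm_real, Real.norm_eq_abs]
      exact mul_le_mul_of_nonneg_left (hR x) (abs_nonneg _)
  exact exists_gap_of_not_hasEigenvalue_one (B := B) hsymm hc hreg

/-- The number of eigenvalues below the threshold, when the quadratic forms of the Birman-Schwinger
operators near the threshold are close to that of an operator `B₀` with a spectral gap at `1`. -/
theorem numEigenvaluesBelow_schrodinger_eq {ε : C(Torus d, ℝ)} {v : PairPotential d}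
    {B₀ : Module.End ℂ (evenL2 d)} {V : Submodule ℂ (evenL2 d)} [FiniteDimensional ℂ V]
    {S : evenL2 d →ₗ[ℂ] V} {δ : ℝ} (hδ : 0 < δ)
    (hpos : ∀ f, S f = 0 → δ * ‖f‖ ^ 2 ≤ ‖f‖ ^ 2 - (inner ℂ f (B₀ f)).re)
    (hneg : ∀ f ∈ V, δ * ‖f‖ ^ 2 ≤ (inner ℂ f (B₀ f)).re - ‖f‖ ^ 2)
    {μ : ℝ} (hμ : 0 < μ) (k τ : Torus d) (hτ : τ + τ = 0) {s₀ : ℝ} (hs₀ : 0 < s₀)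
    (hclose : ∀ s : ℝ, ∀ hs : 0 < s, s ≤ s₀ → ∀ f,
      |(inner ℂ f (sandwich v μ τ hτ (resolventSymbol ε (half k) hs)
        (resolventSymbol_neg ε _ hs) f)).re - (inner ℂ f (B₀ f)).re| ≤ δ / 2 * ‖f‖ ^ 2) :
    numEigenvaluesBelow (schrodinger ε v μ k) (threshold ε k) = Module.finrank ℂ V := by
  set W := sqrtPotential v with hW
  set D := signOp τ hτ with hD
  have hWs : W.IsSymmetric := sqrtPotential_isSymmetric v
  have hDD : ∀ f, D (D f) = f := signOp_signOp hτ
  have hDn : ∀ f, ‖D f‖ = ‖f‖ := norm_signOp hτ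
  have hsand : ∀ s : ℝ, ∀ hs : 0 < s, ∀ φ : evenL2 d,
      (inner ℂ (D φ) (sandwich v μ τ hτ (resolventSymbol ε (half k) hs)
        (resolventSymbol_neg ε _ hs) (D φ))).re
      = μ * (inner ℂ (W φ) (evenMultiplier (resolventSymbol ε (half k) hs)
        (resolventSymbol_neg ε _ hs) (W φ))).re := by
    intro s hs φ
    rw [inner_sandwich, Complex.re_ofReal_mul, ← hD, hDD]
  -- The constraint map tests `D W f` against the negative part of `1 - B₀`; the trial functions are
  -- `(gap + s₀)⁻¹ W D y` with `y ∈ V`.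
  refine numEigenvaluesBelow_eq_of_form (schrodinger_isSymmetric ε v μ k) _
    (S ∘ₗ D ∘ₗ W)
    (evenMultiplier (resolventSymbol ε (half k) hs₀) (resolventSymbol_neg ε _ hs₀) ∘ₗ W ∘ₗ D ∘ₗ
      V.subtype) (fun f hf => ?_) (fun y hy => ?_)
  · have h1 := hpos (D (W f)) hf
    rw [hDn] at h1
    have key : ∀ s : ℝ, 0 < s → s ≤ s₀ →
        threshold ε k * ‖f‖ ^ 2 ≤ (inner ℂ f (schrodinger ε v μ k f)).re + s * ‖f‖ ^ 2 := by
      intro s hs hss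
      have h2 := (abs_le.1 (hclose s hs hss (D (W f)))).2
      rw [hsand s hs, hDn] at h2
      have h3 := two_mul_norm_sq_le hWs (evenMultiplier_isSymmetric (shiftedGap ε (half k) s)
        (shiftedGap_neg ε _ s)) (fun g => re_inner_multiplier_nonneg
          (fun p => (shiftedGap_pos ε (half k) hs p).le) (g : L2 d))
        (evenMultiplier_shiftedGap_resolventSymbol ε (half k) hs) μ f
      rw [re_inner_schrodinger ε v μ k s]
      -- The gap `δ` absorbs the error `δ / 2`. Inserted into `h3`, this leaves `μ ‖W f‖² ≤ ⟨f, (gap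
      -- + s) f⟩`.
      have h4 : μ * (inner ℂ (W (W f)) (evenMultiplier (resolventSymbol ε (half k) hs)
          (resolventSymbol_neg ε _ hs) (W (W f)))).re ≤ ‖W f‖ ^ 2 := by
        have h5 : 0 ≤ δ / 2 * ‖W f‖ ^ 2 := by positivity
        linarith
      have h6 := mul_le_mul_of_nonneg_left h4 hμ.le
      rw [← mul_assoc, ← sq] at h6
      have h7 := h3.trans (add_le_add_right h6 _)
      linarith
    by_contra! hlt
    rcases (norm_nonneg f).eq_or_lt with h0 | h0
    · have h2 := key s₀ hs₀ le_rfl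
      rw [← h0] at h2 hlt
      norm_num at h2 hlt
      linarith
    · have hf2 : 0 < ‖f‖ ^ 2 := by positivity
      set g := threshold ε k * ‖f‖ ^ 2 - (inner ℂ f (schrodinger ε v μ k f)).re with hg
      have hg0 : 0 < g := sub_pos.2 hlt
      -- This replaces the limit `s → 0`: the error `s ‖f‖²` is at most half of the supposed deficit
      -- `g`.
      have h2 := key (min s₀ (g / (2 * ‖f‖ ^ 2))) (by positivity) (min_le_left _ _)
      have h3 : min s₀ (g / (2 * ‖f‖ ^ 2)) * ‖f‖ ^ 2 ≤ g / (2 * ‖f‖ ^ 2) * ‖f‖ ^ 2 :=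
        mul_le_mul_of_nonneg_right (min_le_right _ _) hf2.le
      have h4 : g / (2 * ‖f‖ ^ 2) * ‖f‖ ^ 2 = g / 2 := by field_simp
      linarith
  · have hy0 : 0 < ‖(y : evenL2 d)‖ := norm_pos_iff.2 fun h => hy (Subtype.ext h)
    have h1 := hneg y y.2
    have h2 := (abs_le.1 (hclose s₀ hs₀ le_rfl y)).1
    have h3 := hsand s₀ hs₀ (D y)
    rw [hDD] at h3
    rw [h3] at h2
    have hφ : ‖D (y : evenL2 d)‖ ^ 2 < μ * (inner ℂ (W (D y))
        (evenMultiplier (resolventSymbol ε (half k) hs₀) (resolventSymbol_neg ε _ hs₀)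
          (W (D y)))).re := by
      rw [hDn]
      have h5 : 0 < δ / 2 * ‖(y : evenL2 d)‖ ^ 2 := by positivity
      linarith
    have h4 := re_inner_lt_of_norm_sq_lt hWs
      (evenMultiplier_shiftedGap_resolventSymbol ε (half k) hs₀) hμ hφ
    simp only [LinearMap.comp_apply, Submodule.subtype_apply]
    rw [re_inner_schrodinger ε v μ k s₀]
    set g := evenMultiplier (resolventSymbol ε (half k) hs₀) (resolventSymbol_neg ε _ hs₀)
      (W (D y))
    -- No limit is needed here: being `s₀` below the threshold only strengthens the inequality.
    have h5 : 0 ≤ s₀ * ‖g‖ ^ 2 := by positivity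
    linarith

end Threshold

end LatticePair

/-! ### Local constancy of the number of eigenvalues -/

theorem mainTheorem2 (d : ℕ) (hd : 3 ≤ d)
    (ε : C(LatticePair.Torus d, ℝ)) (hε : LatticePair.IsDispersion ε)
    (v : LatticePair.PairPotential d)
    (μ₀ : ℝ) (hμ₀ : 0 < μ₀)
    (k₀ : LatticePair.Torus d) (hk₀ : k₀ ∈ LatticePair.region ε)
    (hreg : LatticePair.IsRegularPoint ε v μ₀ k₀) :
    ∃ U : Set ℝ, IsOpen U ∧ μ₀ ∈ U ∧ U ⊆ Set.Ioi 0 ∧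
      ∃ G : Set (LatticePair.Torus d), IsOpen G ∧ k₀ ∈ G ∧ G ⊆ LatticePair.region ε ∧
        ∃ n : ℕ, ∀ μ ∈ U, ∀ k ∈ G,
          LatticePair.numEigenvaluesBelow (LatticePair.schrodinger ε v μ k)
            (LatticePair.threshold ε k) = n := by
  have hM : LatticePair.IsMorse (LatticePair.pairDispersion ε k₀) := (interior_subset hk₀).1
  have hC2 : ContDiff ℝ 2 (ε ∘ LatticePair.toTorus) := hε.contDiff.of_le (by norm_num)
  obtain ⟨V, S, δ, hV, hδ, hpos, hneg⟩ :=
    LatticePair.exists_gap_birmanSchwinger hd hC2 hM v μ₀ hreg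
  have hA : 0 ≤ ∑' y, |v.toFun y| := tsum_nonneg fun y => abs_nonneg _
  -- A kernel error `ρ` costs `ρ ∑ |v| ≤ δ / 2` in the form; the `1` covers `v = 0`.
  set ρ := δ / (2 * (∑' y, |v.toFun y| + 1)) with hρ
  have hρ0 : 0 < ρ := by positivity
  have hρA : ρ * ∑' y, |v.toFun y| ≤ δ / 2 := by
    rw [hρ, div_mul_eq_mul_div, div_le_iff₀ (by positivity)]
    nlinarith
  obtain ⟨N, hN, s₀, hs₀, m, hm, hclose⟩ :=
    LatticePair.exists_norm_mul_symbolCoeff_sub_le hd hC2 hM μ₀ hρ0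
  refine ⟨Metric.ball μ₀ m ∩ Set.Ioi 0, Metric.isOpen_ball.inter isOpen_Ioi,
    ⟨Metric.mem_ball_self hm, hμ₀⟩, Set.inter_subset_right,
    LatticePair.region ε ∩ interior {k | ∃ τ : LatticePair.Torus d, τ + τ = 0 ∧
      LatticePair.half k + τ ∈ N}, isOpen_interior.inter isOpen_interior,
    ⟨hk₀, mem_interior_iff_mem_nhds.2 (LatticePair.eventually_half_add_mem k₀ hN)⟩,
    Set.inter_subset_left, Module.finrank ℂ V, ?_⟩
  rintro μ ⟨hμ, hμ0⟩ k ⟨-, hk⟩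
  obtain ⟨τ, hτ, hkN⟩ := interior_subset hk
  refine LatticePair.numEigenvaluesBelow_schrodinger_eq hδ hpos hneg hμ0 k τ hτ hs₀
    fun s hs hss f => ?_
  refine ((LatticePair.isSandwich_sandwich v μ τ hτ _ _).abs_re_inner_sub_le
    (LatticePair.isSandwich_birmanSchwinger ε v μ₀ k₀) hρ0.le (fun x => ?_) f).trans
    (mul_le_mul_of_nonneg_right hρA (sq_nonneg _))
  -- The character turns the kernel at `half k` into the one at `half k + τ`, which lies in `N` even
  -- if `half k` does not.
  rw [← LatticePair.symbolCoeff_resolventSymbol_add ε _ hτ hs]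
  exact hclose _ hkN s hs hss μ (Metric.mem_ball.1 hμ).le x
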